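/- **Proposition (Energy evolution).** Let $(M,g_0)$ be a closed smooth Riemannian $3$-manifold with a smooth global $g_0$-orthonormal frame $E_1,E_2,E_3$, and let its spinor bundle be trivialized by this frame, so that spinor fields are maps $M\to\mathbb C^2$ and $E_k$ acts by Clifford multiplication through matrices $\gamma_k=i\sigma_k$ ($\sigma_k$ the Pauli matrices), $\gamma_i\gamma_j+\gamma_j\gamma_i=-2\delta_{ij}$. For a nowhere vanishing spinor field $\psi$ put $\rho=|\psi|$, $g(\psi)=\rho^2g_0$, with orthonormal frame $e_k=\rho^{-1}E_k$; spinors of $g_0$ and $g(\psi)$ with the same components in these frames are identified. Let $dV_{g(\psi)}$ be the Riemannian volume measure and $$D_{g(\psi)}\varphi=\sum_k\gamma_k\nabla_{e_k}\varphi,\qquad \nabla_{e_k}\varphi=e_k(\varphi)+\tfrac14\sum_{i,j}g(\nabla^{g}_{e_k}e_i,e_j)\,\gamma_i\gamma_j\varphi ,\qquad g=g(\psi),$$ the Dirac operator of $g(\psi)$, where $\nabla^g$ is the Levi-Civita connection. Put $E[\psi]=\int_M|D_{g(\psi)}\psi|^2\,dV_{g(\psi)}$. Let $\psi$ be a smooth,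 nowhere vanishing solution of $\partial_t\psi=-D_{g(\psi)}^2\psi$ on $M\times(0,T)$. Then for every $t\in(0,T)$, with $g=g(\psi(t))$, $D=D_{g(\psi(t))}$ and $h=\partial_tg(\psi(t))$, the energy is differentiable at $t$, all integrals below converge absolutely, and $$\frac{d}{dt}E[\psi(t)]=-2\int_M|D^2\psi|^2\,dV_g+\mathcal R(\psi,\partial_tg),$$ $$\mathcal R(\psi,h)=2\int_M\operatorname{Re}\langle\dot D_h\psi,D\psi\rangle\,dV_g+\int_M\tfrac12(\operatorname{tr}_gh)\,|D\psi|^2\,dV_g,$$ where $\dot D_h\varphi=\tfrac16\big(\operatorname{grad}_g(\operatorname{tr}_gh)\cdot\varphi-(\operatorname{tr}_gh)\,D\varphi\big)$ and $\cdot$ is Clifford multiplication for $g$. The two terms of $\mathcal R$ are those that come from the time dependence of the metric in the Dirac operator and of the volume form: the metric varies conformally, $h=\tfrac13(\operatorname{tr}_gh)\,g$; for every smooth spinor field $\varphi$ independent of time, $\partial_t\big(D_{g(\psi(t))}\varphi\big)=\dot D_h\varphi$ pointwise; and $\partial_t\,dV_{g(\psi(t))}=\tfrac12(\operatorname{tr}_gh)\,dV_g$,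 i.e. $\frac{d}{dt}\operatorname{vol}_{g(\psi(t))}(A)=\int_A\tfrac12(\operatorname{tr}_gh)\,dV_g$ for every Borel set $A\subseteq M$. -/

import Mathlib

open Set MeasureTheory
open scoped Manifold ContDiff

noncomputable section

namespace SpinorFlow

/-- The model space of a 3-manifold. -/
abbrev Model : Type := EuclideanSpace ℝ (Fin 3)

/-- The fibre `ℂ²` of the trivialized spinor bundle, with its Hermitian norm. -/
abbrev Spinor : Type := EuclideanSpace ℂ (Fin 2)

/-! ### Clifford multiplication -/

/-- The matrices `i σ₁, i σ₂, i σ₃` (`σₖ` the Pauli matrices). -/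
def gamma : Fin 3 → Matrix (Fin 2) (Fin 2) ℂ :=
  ![!![0, Complex.I; Complex.I, 0], !![0, 1; -1, 0], !![Complex.I, 0; 0, -Complex.I]]

/-- Clifford multiplication by the `k`-th vector of an orthonormal frame. -/
def clifford (k : Fin 3) : Spinor →L[ℂ] Spinor :=
  Matrix.toEuclideanCLM (n := Fin 2) (𝕜 := ℂ) (gamma k)

/-- The Clifford relations `γᵢ γⱼ + γⱼ γᵢ = -2 δᵢⱼ`. -/
theorem gamma_relations (i j : Fin 3) :
    gamma i * gamma j + gamma j * gamma i = if i = j then -2 else 0 := by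
  fin_cases i <;> fin_cases j <;> ext a b <;> fin_cases a <;> fin_cases b <;>
    simp [gamma, ← Matrix.diagonal_ofNat'] <;> norm_num

/-- Clifford multiplication by a vector is skew-Hermitian. -/
theorem gamma_conjTranspose (i : Fin 3) : (gamma i).conjTranspose = -gamma i := by
  fin_cases i <;> ext a b <;> fin_cases a <;> fin_cases b <;> simp [gamma]

/-! ### Riemannian geometry -/

section Geometry

variable {M : Type*} [TopologicalSpace M] [ChartedSpace Model M]

/-- Fields of bilinear forms on the tangent spaces; a Riemannian metric is such a field. -/
abbrev FormField (M : Type*) [TopologicalSpace M] [ChartedSpace Model M] : Type _ :=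
  ∀ x : M, TangentSpace (𝓡 3) x →L[ℝ] TangentSpace (𝓡 3) x →L[ℝ] ℝ

/-- Vector fields on `M`. -/
abbrev VField (M : Type*) [TopologicalSpace M] [ChartedSpace Model M] : Type _ :=
  ∀ x : M, TangentSpace (𝓡 3) x

/-- `g(∇_X Y, Z)` at `x` for the Levi-Civita connection `∇` of `g` (Koszul formula). -/
def leviCivita (g : FormField M) (X Y Z : VField M) (x : M) : ℝ :=
  (1 / 2) *
    (mvfderiv (𝓡 3) (fun y => g y (Y y) (Z y)) x (X x)
      + mvfderiv (𝓡 3) (fun y => g y (Z y) (X y)) x (Y x)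
      - mvfderiv (𝓡 3) (fun y => g y (X y) (Y y)) x (Z x)
      + g x (VectorField.mlieBracket (𝓡 3) X Y x) (Z x)
      - g x (VectorField.mlieBracket (𝓡 3) Y Z x) (X x)
      + g x (VectorField.mlieBracket (𝓡 3) Z X x) (Y x))

/-- The density `√det (g(∂ᵢ, ∂ⱼ))` of `g` in the preferred chart at `c`, at the point with
coordinates `y`. -/
def chartDensity (g : FormField M) (c : M) (y : Model) : ℝ :=
  let d : Fin 3 → TangentSpace (𝓡 3) ((extChartAt (𝓡 3) c).symm y) := fun i =>
    mfderiv 𝓘(ℝ, Model) (𝓡 3) (extChartAt (𝓡 3) c).symm y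
      (EuclideanSpace.single i (1 : ℝ) : Model)
  √(Matrix.det (Matrix.of fun i j : Fin 3 => g ((extChartAt (𝓡 3) c).symm y) (d i) (d j)))

/-- The Riemannian volume of `g` on the domain of the preferred chart at `c`, extended by zero:
Lebesgue measure with density `√det g`, transported to `M`. -/
def chartVolume [MeasurableSpace M] (g : FormField M) (c : M) : Measure M :=
  Measure.map (extChartAt (𝓡 3) c).symm
    ((volume.restrict (extChartAt (𝓡 3) c).target).withDensity
      fun y => ENNReal.ofReal (chartDensity g c y))

/-- The Riemannian volume measure `dV_g`. The measures `chartVolume g c` are the restrictions of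
`dV_g` to the chart domains, so that `dV_g` is their least upper bound. -/
def volumeMeasure [MeasurableSpace M] (g : FormField M) : Measure M :=
  ⨆ c : M, chartVolume g c

/-! ### The Dirac operator

`e` is a global `g`-orthonormal frame; it trivializes the spinor bundle of `(M, g)`, and spinor
fields are maps `M → ℂ²`. -/

/-- The spinorial Levi-Civita derivative
`∇_{eₖ} φ = eₖ(φ) + ¼ ∑ᵢⱼ g(∇_{eₖ} eᵢ, eⱼ) γᵢ γⱼ φ`. -/
def spinDeriv (g : FormField M) (e : Fin 3 → VField M) (k : Fin 3) (φ : M → Spinor) (x : M) :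
    Spinor :=
  mvfderiv (𝓡 3) φ x (e k x) +
    (1 / 4 : ℝ) • ∑ i, ∑ j, leviCivita g (e k) (e i) (e j) x • clifford i (clifford j (φ x))

/-- The Dirac operator `D φ = ∑ₖ eₖ · ∇_{eₖ} φ`. -/
def dirac (g : FormField M) (e : Fin 3 → VField M) (φ : M → Spinor) (x : M) : Spinor :=
  ∑ k, clifford k (spinDeriv g e k φ x)

/-! ### The geometry induced by a spinor field -/

/-- The metric `g(ψ) = ρ² g₀`, `ρ = |ψ|`. -/
def inducedMetric (g₀ : FormField M) (ψ : M → Spinor) : FormField M :=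
  fun x => (‖ψ x‖ ^ 2) • g₀ x

/-- The `g(ψ)`-orthonormal frame `ρ⁻¹ Eₖ` obtained from a `g₀`-orthonormal frame `E`. Spinors of
`g₀` and of `g(ψ)` with the same components in the two frames are identified. -/
def inducedFrame (E : Fin 3 → VField M) (ψ : M → Spinor) : Fin 3 → VField M :=
  fun k x => ‖ψ x‖⁻¹ • E k x

/-- The Dirac operator `D_{g(ψ)}`. -/
def inducedDirac (g₀ : FormField M) (E : Fin 3 → VField M) (ψ φ : M → Spinor) : M → Spinor :=
  dirac (inducedMetric g₀ ψ) (inducedFrame E ψ) φ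

/-- The volume measure `dV_{g(ψ)}`. -/
def inducedVolume [MeasurableSpace M] (g₀ : FormField M) (ψ : M → Spinor) : Measure M :=
  volumeMeasure (inducedMetric g₀ ψ)

/-- The energy `E[ψ] = ∫ |D_{g(ψ)} ψ|² dV_{g(ψ)}`. -/
def energy [MeasurableSpace M] (g₀ : FormField M) (E : Fin 3 → VField M) (ψ : M → Spinor) : ℝ :=
  ∫ x, ‖inducedDirac g₀ E ψ ψ x‖ ^ 2 ∂(inducedVolume g₀ ψ)

/-- The velocity `∂ₜ g` of the metric `g(ψ(t))`, at time `t`. -/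
def metricVelocity (g₀ : FormField M) (ψ : ℝ → M → Spinor) (t : ℝ) (x : M)
    (v w : TangentSpace (𝓡 3) x) : ℝ :=
  deriv (fun s => inducedMetric g₀ (ψ s) x v w) t

/-! ### The reaction term -/

/-- The trace `∑ₖ h(eₖ, eₖ)` of a field of bilinear forms. -/
def frameTrace (e : Fin 3 → VField M)
    (h : ∀ x : M, TangentSpace (𝓡 3) x → TangentSpace (𝓡 3) x → ℝ) (x : M) : ℝ :=
  ∑ k, h x (e k x) (e k x)

/-- The first variation of the Dirac operator along a conformal variation `h = (tr_g h / 3) g` of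
the metric: `Ḋ_h φ = ⅙ (grad_g (tr_g h) · φ - (tr_g h) D φ)`. -/
def diracVariation (g : FormField M) (e : Fin 3 → VField M)
    (h : ∀ x : M, TangentSpace (𝓡 3) x → TangentSpace (𝓡 3) x → ℝ) (φ : M → Spinor) (x : M) :
    Spinor :=
  (1 / 6 : ℝ) •
    ((∑ k, mvfderiv (𝓡 3) (frameTrace e h) x (e k x) • clifford k (φ x))
      - frameTrace e h x • dirac g e φ x)

/-- The part of `R(φ, h)` due to the variation of the Dirac operator with the metric,
`2 Re ⟨Ḋ_h φ, D φ⟩`, as a density with respect to `dV_g`. -/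
def metricReaction (g : FormField M) (e : Fin 3 → VField M)
    (h : ∀ x : M, TangentSpace (𝓡 3) x → TangentSpace (𝓡 3) x → ℝ) (φ : M → Spinor) (x : M) : ℝ :=
  2 * (inner ℂ (diracVariation g e h φ x) (dirac g e φ x)).re

/-- The part of `R(φ, h)` due to the variation `½ (tr_g h) dV_g` of the volume form,
`½ (tr_g h) |D φ|²`, as a density with respect to `dV_g`. -/
def volumeReaction (g : FormField M) (e : Fin 3 → VField M)
    (h : ∀ x : M, TangentSpace (𝓡 3) x → TangentSpace (𝓡 3) x → ℝ) (φ : M → Spinor) (x : M) : ℝ :=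
  (1 / 2) * frameTrace e h x * ‖dirac g e φ x‖ ^ 2

/-- The reaction term `R(φ, h)`. -/
def reaction [MeasurableSpace M] (g : FormField M) (e : Fin 3 → VField M)
    (h : ∀ x : M, TangentSpace (𝓡 3) x → TangentSpace (𝓡 3) x → ℝ) (φ : M → Spinor) : ℝ :=
  (∫ x, metricReaction g e h φ x ∂(volumeMeasure g))
    + ∫ x, volumeReaction g e h φ x ∂(volumeMeasure g)

end Geometry

end SpinorFlow

end

/-!
In a `g`-orthonormal frame the structure functions determine the connection coefficients by Koszul's
formula, so the Dirac operator of `r² g` in the frame `r⁻¹ eₖ` differs from `r⁻¹ D_g` only by an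
explicit zeroth order term, linear in the derivatives of `r⁻¹`. Differentiating in time gives `Ḋ_h`
with `tr h = 6 ∂ₜr / r`, while `dV_{r² g} = r³ dV_g` gives the variation `3 ∂ₜr / r` of the volume.

What remains of the derivative of the energy is `2 ∫ Re ⟨D ∂ₜψ, D ψ⟩`. The Dirac operator is
symmetric, because by the Clifford relations `Re ⟨D u, v⟩ - Re ⟨u, D v⟩` is the divergence of the
vector field with components `Re ⟨γₖ u, v⟩`. Along the flow the term is thus `-2 ∫ |D² ψ|²`.
-/

noncomputable section

namespace SpinorFlow

/-! ### Clifford algebra -/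

theorem clifford_real_smul (k : Fin 3) (r : ℝ) (v : Spinor) :
    clifford k (r • v) = r • clifford k v :=
  (clifford k).map_smul_of_tower r v

theorem adjoint_clifford (k : Fin 3) :
    ContinuousLinearMap.adjoint (clifford k) = -clifford k := by
  rw [← ContinuousLinearMap.star_eq_adjoint, clifford, ← map_star, Matrix.star_eq_conjTranspose,
    gamma_conjTranspose, map_neg]

theorem re_inner_eq_real_inner (u v : Spinor) : (inner ℂ u v).re = inner ℝ u v :=
  rfl

theorem real_inner_clifford_left (k : Fin 3) (u v : Spinor) :
    inner ℝ (clifford k u) v = -inner ℝ u (clifford k v) := by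
  rw [← re_inner_eq_real_inner, ← re_inner_eq_real_inner,
    ← ContinuousLinearMap.adjoint_inner_right, adjoint_clifford, _root_.neg_apply,
    inner_neg_right, Complex.neg_re]

theorem clifford_clifford_add (i j : Fin 3) (v : Spinor) :
    clifford i (clifford j v) + clifford j (clifford i v)
      = (if i = j then (-2 : ℝ) else 0) • v := by
  have h := congrArg (Matrix.toEuclideanCLM (n := Fin 2) (𝕜 := ℂ)) (gamma_relations i j)
  rw [map_add, map_mul, map_mul] at h
  refine (congrArg (fun A : Spinor →L[ℂ] Spinor => A v) h).trans ?_
  split_ifs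
  · rw [map_neg, map_ofNat, _root_.neg_apply, ContinuousLinearMap.ofNat_apply, neg_smul,
      ofNat_smul_eq_nsmul ℝ]
  · simp

theorem clifford_clifford_self (k : Fin 3) (v : Spinor) : clifford k (clifford k v) = -v := by
  have h := clifford_clifford_add k k v
  rw [if_pos rfl, ← two_smul ℝ, neg_smul, ← smul_neg] at h
  exact smul_right_injective _ (two_ne_zero (α := ℝ)) h

theorem clifford_clifford_swap (i j : Fin 3) (v : Spinor) :
    clifford i (clifford j v) = (if i = j then (-2 : ℝ) else 0) • v - clifford j (clifford i v) :=
  eq_sub_of_add_eq (clifford_clifford_add i j v)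

theorem sum_clifford_clifford_clifford (i : Fin 3) (v : Spinor) :
    ∑ k, clifford k (clifford i (clifford k v)) = clifford i v := by
  have swap (k : Fin 3) : clifford k (clifford i (clifford k v))
      = clifford i v + (if i = k then (-2 : ℝ) else 0) • clifford k v := by
    rw [clifford_clifford_swap i, map_sub, clifford_real_smul, clifford_clifford_self]
    abel
  simp only [swap, Finset.sum_add_distrib, ite_smul, zero_smul, Finset.sum_ite_eq,
    Finset.mem_univ, if_true, Finset.sum_const, Finset.card_univ, Fintype.card_fin]
  module

/-- In dimension three the conformal change of the connection contributes `-(3 + 1) / 4`. -/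
theorem sum_clifford_conformal (a : Fin 3 → ℝ) (v : Spinor) :
    (1 / 4 : ℝ) • ∑ k, ∑ i, ∑ j, ((if i = k then a j else 0) - (if j = k then a i else 0)) •
      clifford k (clifford i (clifford j v)) = -∑ k, a k • clifford k v := by
  simp only [sub_smul, ite_smul, zero_smul, Finset.sum_sub_distrib]
  have h₁ : ∑ k, ∑ i, ∑ j, (if i = k then a j • clifford k (clifford i (clifford j v)) else 0)
      = -(3 : ℝ) • ∑ j, a j • clifford j v := by
    simp [Finset.sum_ite_irrel, clifford_clifford_self]
    module
  have h₂ : ∑ k, ∑ i, ∑ j, (if j = k then a i • clifford k (clifford i (clifford j v)) else 0)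
      = ∑ i, a i • clifford i v := by
    simp only [Finset.sum_ite_eq', Finset.mem_univ, if_true]
    rw [Finset.sum_comm]
    simp only [← Finset.smul_sum, sum_clifford_clifford_clifford]
  rw [h₁, h₂]
  module

theorem clifford_clifford_clifford_add_reverse (k i j : Fin 3) (v : Spinor) :
    clifford k (clifford i (clifford j v)) + clifford j (clifford i (clifford k v))
      = (if j = k then (2 : ℝ) else 0) • clifford i v
        - (if i = k then (2 : ℝ) else 0) • clifford j v
        - (if i = j then (2 : ℝ) else 0) • clifford k v := by
  rw [clifford_clifford_swap i k, map_sub, clifford_real_smul, clifford_clifford_swap j k,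
    clifford_clifford_swap i j, map_sub, clifford_real_smul]
  split_ifs <;> module

/-- Only the divergences of the frame contribute, as a reversed triple product differs from its
opposite by contractions. -/
theorem inner_connection_sub {κ : Fin 3 → Fin 3 → Fin 3 → ℝ}
    (hκ : ∀ k i j, κ k i j = -κ k j i) (u v : Spinor) :
    inner ℝ ((1 / 4 : ℝ) • ∑ k, ∑ i, ∑ j, κ k i j • clifford k (clifford i (clifford j u))) v
      - inner ℝ u ((1 / 4 : ℝ) • ∑ k, ∑ i, ∑ j, κ k i j • clifford k (clifford i (clifford j v)))
      = ∑ k, (∑ i, κ i k i) * inner ℝ (clifford k u) v := by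
  have reverse (k i j : Fin 3) : inner ℝ u (clifford k (clifford i (clifford j v)))
      = -inner ℝ (clifford j (clifford i (clifford k u))) v := by
    simp only [real_inner_clifford_left, neg_neg]
  have contract (k i j : Fin 3) : inner ℝ (clifford k (clifford i (clifford j u))) v
      + inner ℝ (clifford j (clifford i (clifford k u))) v
      = (if j = k then 2 else 0) * inner ℝ (clifford i u) v
        - (if i = k then 2 else 0) * inner ℝ (clifford j u) v
        - (if i = j then 2 else 0) * inner ℝ (clifford k u) v := by
    rw [← inner_add_left, clifford_clifford_clifford_add_reverse, inner_sub_left, inner_sub_left,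
      real_inner_smul_left, real_inner_smul_left, real_inner_smul_left]
  have diag (k i : Fin 3) : κ k i i = 0 := self_eq_neg.1 (hκ k i i)
  have skew (k i : Fin 3) : κ k k i = -κ k i k := hκ k k i
  simp only [real_inner_smul_left, real_inner_smul_right, sum_inner, inner_sum, reverse,
    ← mul_sub, ← Finset.sum_sub_distrib, sub_neg_eq_add, contract]
  simp only [mul_sub, ite_mul, mul_ite, zero_mul, mul_zero, Finset.sum_sub_distrib,
    Finset.sum_ite_irrel, Finset.sum_ite_eq, Finset.sum_ite_eq', Finset.mem_univ, if_true,
    Finset.sum_const_zero, diag, skew]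
  simp only [Fin.sum_univ_three]
  ring

/-! ### Differential calculus on manifolds -/

section DirectionalDerivative

variable {𝕜 : Type*} [NontriviallyNormedField 𝕜]
  {V H : Type*} [NormedAddCommGroup V] [NormedSpace 𝕜 V] [TopologicalSpace H]
  {I : ModelWithCorners 𝕜 V H} {M : Type*} [TopologicalSpace M] [ChartedSpace H M]
  {F G : Type*} [NormedAddCommGroup F] [NormedSpace 𝕜 F] [NormedAddCommGroup G] [NormedSpace 𝕜 G]

theorem contMDiffAt_mvfderiv_apply {W HN : Type*} [NormedAddCommGroup W] [NormedSpace 𝕜 W]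
    [TopologicalSpace HN] {J : ModelWithCorners 𝕜 W HN} {N : Type*} [TopologicalSpace N]
    [ChartedSpace HN N] [IsManifold I 1 M] [IsManifold J 1 N] {m n : WithTop ℕ∞} (hmn : m + 1 ≤ n)
    {f : N → M → F} {b : N → M} {X : ∀ p, TangentSpace I (b p)} {p₀ : N}
    (hf : ContMDiffAt (J.prod I) 𝓘(𝕜, F) n (Function.uncurry f) (p₀, b p₀))
    (hX : ContMDiffAt J I.tangent m (fun p => (⟨b p, X p⟩ : TangentBundle I M)) p₀) :
    ContMDiffAt J 𝓘(𝕜, F) m (fun p => mvfderiv I (f p) (b p) (X p)) p₀ := by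
  have hb : ContMDiffAt J I m b p₀ := (Bundle.contMDiffAt_totalSpace.1 hX).1
  have hfb : ContMDiffAt J 𝓘(𝕜, F) m (fun p => f p (b p)) p₀ :=
    (hf.of_le (le_self_add.trans hmn)).comp p₀ (contMDiffAt_id.prodMk hb)
  have h := ContMDiffWithinAt.clm_apply_of_inCoordinates (s := univ)
    (ϕ := fun p => mfderiv I 𝓘(𝕜, F) (f p) (b p)) (hf.mfderiv f b hb hmn) hX hfb
  exact (contMDiff_snd_tangentBundle_modelSpace F 𝓘(𝕜, F)).contMDiffAt.comp p₀ h

theorem mvfderiv_comp_of_hasFDerivAt {f : M → F} {L : F → G} {L' : F →L[𝕜] G} {x : M}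
    (hL : HasFDerivAt L L' (f x)) (hf : MDifferentiableAt I 𝓘(𝕜, F) f x) (v : TangentSpace I x) :
    mvfderiv I (fun y => L (f y)) x v = L' (mvfderiv I f x v) :=
  congrArg (fun A => A v) (HasMFDerivAt.comp x hL.hasMFDerivAt hf.hasMFDerivAt).mfderiv

theorem mvfderiv_congr_of_eventuallyEq {f g : M → F} {x : M} (h : f =ᶠ[nhds x] g)
    (v : TangentSpace I x) : mvfderiv I f x v = mvfderiv I g x v :=
  congrArg (fun A => A v) (h.mfderiv_eq (I := I) (I' := 𝓘(𝕜, F)))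

theorem mvfderiv_finsetSum {ι : Type*} {s : Finset ι} {f : ι → M → F} {x : M}
    (hf : ∀ i ∈ s, MDifferentiableAt I 𝓘(𝕜, F) (f i) x) :
    mvfderiv I (∑ i ∈ s, f i) x = ∑ i ∈ s, mvfderiv I (f i) x := by
  suffices MDifferentiableAt I 𝓘(𝕜, F) (∑ i ∈ s, f i) x ∧
      mvfderiv I (∑ i ∈ s, f i) x = ∑ i ∈ s, mvfderiv I (f i) x from this.2
  induction s using Finset.cons_induction with
  | empty => exact ⟨mdifferentiableAt_const, mfderiv_const⟩
  | cons i s hi ih =>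
    have hfi := hf i (Finset.mem_cons_self i s)
    obtain ⟨hfs, hsum⟩ := ih fun j hj => hf j (Finset.mem_cons_of_mem hj)
    rw [Finset.sum_cons, Finset.sum_cons, mvfderiv_add hfi hfs, hsum]
    exact ⟨hfi.add hfs, rfl⟩

theorem mvfderiv_eq_fderiv_comp_extChartAt_symm [I.Boundaryless] {f : M → F} {x : M}
    (hf : MDifferentiableAt I 𝓘(𝕜, F) f x) (v : TangentSpace I x) :
    mvfderiv I f x v = fderiv 𝕜 (fun y => f ((extChartAt I x).symm y)) (extChartAt I x x) v := by
  rw [hf.mvfderiv, I.range_eq_univ, fderivWithin_univ]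
  rfl

end DirectionalDerivative

section MixedPartialDerivatives

variable {V F : Type*} [NormedAddCommGroup V] [NormedSpace ℝ V]
  [NormedAddCommGroup F] [NormedSpace ℝ F] {K : ℝ × V → F} {t : ℝ} {y : V}

theorem fderiv_prodMk_right_apply (hK : DifferentiableAt ℝ K (t, y)) (v : V) :
    fderiv ℝ (fun z => K (t, z)) y v = fderiv ℝ K (t, y) (0, v) :=
  congrArg (fun A => A v) (hK.hasFDerivAt.comp y (hasFDerivAt_prodMk_right t y)).fderiv

theorem hasDerivAt_comp_prodMk_left (hK : DifferentiableAt ℝ K (t, y)) :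
    HasDerivAt (fun s => K (s, y)) (fderiv ℝ K (t, y) (1, 0)) t :=
  hK.hasFDerivAt.comp_hasDerivAt t ((hasDerivAt_id t).prodMk (hasDerivAt_const t y))

theorem hasDerivAt_fderiv_apply (hK : ContDiffAt ℝ 2 K (t, y)) (v : V) :
    HasDerivAt (fun s => fderiv ℝ (fun z => K (s, z)) y v)
      (fderiv ℝ (fun z => deriv (fun s => K (s, z)) t) y v) t := by
  have hdiff : ∀ᶠ q in nhds (t, y), DifferentiableAt ℝ K q :=
    ((hK.of_le one_le_two).eventually (by simp)).mono fun q hq => hq.differentiableAt (by simp)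
  have hspace : ∀ᶠ s in nhds t, fderiv ℝ (fun z => K (s, z)) y v = fderiv ℝ K (s, y) (0, v) :=
    ((Continuous.prodMk_left y).tendsto t |>.eventually hdiff).mono
      fun s hs => fderiv_prodMk_right_apply hs v
  have htime : (fun z => deriv (fun s => K (s, z)) t) =ᶠ[nhds y]
      fun z => fderiv ℝ K (t, z) (1, 0) :=
    ((Continuous.prodMk_right t).tendsto y |>.eventually hdiff).mono
      fun z hz => (hasDerivAt_comp_prodMk_left hz).deriv
  have hK' : DifferentiableAt ℝ (fderiv ℝ K) (t, y) :=
    (hK.fderiv_right (m := 1) (by norm_num)).differentiableAt (by simp)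
  have hsymm : IsSymmSndFDerivAt ℝ K (t, y) := hK.isSymmSndFDerivAt (by simp)
  have happly (w : ℝ × V) : DifferentiableAt ℝ (fun q => fderiv ℝ K q w) (t, y) :=
    hK'.clm_apply (differentiableAt_const w)
  have hsecond (w q : ℝ × V) :
      fderiv ℝ (fun p => fderiv ℝ K p w) (t, y) q = fderiv ℝ (fderiv ℝ K) (t, y) q w := by
    rw [fderiv_clm_apply hK' (differentiableAt_const w)]
    simp
  rw [htime.fderiv_eq, fderiv_prodMk_right_apply (happly _), hsecond, hsymm.eq, ← hsecond]
  exact (hasDerivAt_comp_prodMk_left (happly _)).congr_of_eventuallyEq hspace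

end MixedPartialDerivatives

section SmoothFamily

variable {V H : Type*} [NormedAddCommGroup V] [NormedSpace ℝ V] [TopologicalSpace H]
  {I : ModelWithCorners ℝ V H} {M : Type*} [TopologicalSpace M] [ChartedSpace H M]
  {F G : Type*} [NormedAddCommGroup F] [NormedSpace ℝ F] [NormedAddCommGroup G] [NormedSpace ℝ G]

variable (I) in
/-- Families `f t` of functions on `M`, jointly smooth in the point and the time `t ∈ U`. -/
def SmoothFamily (U : Set ℝ) (f : ℝ → M → F) : Prop :=
  ∀ t ∈ U, ∀ x, ContMDiffAt (𝓘(ℝ, ℝ).prod I) 𝓘(ℝ, F) ∞ (fun p : ℝ × M => f p.1 p.2) (t, x)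

namespace SmoothFamily

variable {U : Set ℝ} {f g : ℝ → M → F} {t : ℝ}

theorem contMDiff (hf : SmoothFamily I U f) (ht : t ∈ U) : ContMDiff I 𝓘(ℝ, F) ∞ (f t) := fun x =>
  (hf t ht x).comp x (f := fun y : M => (t, y)) (contMDiffAt_const.prodMk contMDiffAt_id)

theorem mdifferentiableAt (hf : SmoothFamily I U f) (ht : t ∈ U) (x : M) :
    MDifferentiableAt I 𝓘(ℝ, F) (f t) x :=
  (hf.contMDiff ht).mdifferentiableAt (by simp)

theorem hasDerivAt (hf : SmoothFamily I U f) (ht : t ∈ U) (x : M) :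
    HasDerivAt (fun s => f s x) (deriv (fun s => f s x) t) t :=
  (((hf t ht x).comp t (f := fun s : ℝ => (s, x))
    (contMDiffAt_id.prodMk contMDiffAt_const)).contDiffAt.differentiableAt (by simp)).hasDerivAt

theorem continuousOn (hf : SmoothFamily I U f) :
    ContinuousOn (fun p : ℝ × M => f p.1 p.2) (U ×ˢ univ) :=
  fun p hp => (hf p.1 hp.1 p.2).continuousAt.continuousWithinAt

theorem congr (hf : SmoothFamily I U f) (hU : IsOpen U)
    (h : ∀ t ∈ U, ∀ x, g t x = f t x) : SmoothFamily I U g := fun t ht x =>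
  (hf t ht x).congr_of_eventuallyEq <| Filter.mem_of_superset
    (prod_mem_nhds (hU.mem_nhds ht) Filter.univ_mem) fun p hp => h p.1 hp.1 p.2

theorem const {φ : M → F} (hφ : ContMDiff I 𝓘(ℝ, F) ∞ φ) : SmoothFamily I U (fun _ => φ) :=
  fun t _ x => (hφ.comp contMDiff_snd) (t, x)

theorem comp {L : F → G} (hf : SmoothFamily I U f) (hL : ∀ t ∈ U, ∀ x, ContDiffAt ℝ ∞ L (f t x)) :
    SmoothFamily I U (fun s x => L (f s x)) :=
  fun t ht x => ContMDiffAt.comp (t, x) (g := L) (hL t ht x).contMDiffAt (hf t ht x)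

theorem add (hf : SmoothFamily I U f) (hg : SmoothFamily I U g) :
    SmoothFamily I U (fun s x => f s x + g s x) :=
  fun t ht x => (hf t ht x).add (hg t ht x)

theorem sub (hf : SmoothFamily I U f) (hg : SmoothFamily I U g) :
    SmoothFamily I U (fun s x => f s x - g s x) :=
  fun t ht x => (hf t ht x).sub (hg t ht x)

theorem smul {r : ℝ → M → ℝ} (hr : SmoothFamily I U r) (hf : SmoothFamily I U f) :
    SmoothFamily I U (fun s x => r s x • f s x) :=
  fun t ht x => (hr t ht x).smul (hf t ht x)

theorem sum {ι : Type*} {s : Finset ι} {f : ι → ℝ → M → F} (hf : ∀ i ∈ s, SmoothFamily I U (f i)) :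
    SmoothFamily I U (fun t x => ∑ i ∈ s, f i t x) :=
  fun t ht x => contMDiffAt_finsetSum fun i hi => hf i hi t ht x

theorem inv₀ {r : ℝ → M → ℝ} (hr : SmoothFamily I U r) (hr₀ : ∀ t ∈ U, ∀ x, r t x ≠ 0) :
    SmoothFamily I U (fun s x => (r s x)⁻¹) :=
  fun t ht x => (hr t ht x).inv₀ (hr₀ t ht x)

theorem norm {F : Type*} [NormedAddCommGroup F] [InnerProductSpace ℝ F] {f : ℝ → M → F}
    (hf : SmoothFamily I U f) (hf₀ : ∀ t ∈ U, ∀ x, f t x ≠ 0) :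
    SmoothFamily I U (fun s x => ‖f s x‖) :=
  hf.comp fun t ht x => contDiffAt_norm ℝ (hf₀ t ht x)

protected theorem deriv [IsManifold I 1 M] (hf : SmoothFamily I U f) :
    SmoothFamily I U (fun s x => deriv (fun τ => f τ x) s) := by
  intro t ht x
  have hf' : ContMDiffAt ((𝓘(ℝ, ℝ).prod I).prod 𝓘(ℝ, ℝ)) 𝓘(ℝ, F) ∞
      (fun q : (ℝ × M) × ℝ => f q.2 q.1.2) ((t, x), t) :=
    (hf t ht x).comp ((t, x), t) (f := fun q : (ℝ × M) × ℝ => (q.2, q.1.2))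
      (contMDiffAt_snd.prodMk (contMDiff_snd.comp contMDiff_fst).contMDiffAt)
  have hone : ContMDiff 𝓘(ℝ, ℝ) 𝓘(ℝ, ℝ).tangent ∞
      (fun s : ℝ => (⟨s, (1 : ℝ)⟩ : TangentBundle 𝓘(ℝ, ℝ) ℝ)) := fun s =>
    contMDiffAt_vectorSpace_iff_contDiffAt.2 contDiffAt_const
  refine (contMDiffAt_mvfderiv_apply (I := 𝓘(ℝ, ℝ)) (J := 𝓘(ℝ, ℝ).prod I) (m := ∞) (n := ∞)
    (f := fun (p : ℝ × M) τ => f τ p.2) (b := Prod.fst) (X := fun _ => (1 : ℝ)) (by simp) hf'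
    ((hone t).comp (t, x) contMDiffAt_fst)).congr_of_eventuallyEq (.of_forall fun p => ?_)
  change _ = mfderiv 𝓘(ℝ, ℝ) 𝓘(ℝ, F) (fun τ => f τ p.2) p.1 (1 : ℝ)
  rw [mfderiv_eq_fderiv]
  rfl

protected theorem mvfderiv [IsManifold I 1 M] (hf : SmoothFamily I U f)
    {X : ∀ x : M, TangentSpace I x}
    (hX : ContMDiff I I.tangent ∞ (fun x => (⟨x, X x⟩ : TangentBundle I M))) :
    SmoothFamily I U (fun s x => mvfderiv I (f s) x (X x)) := by
  intro t ht x
  refine contMDiffAt_mvfderiv_apply (J := 𝓘(ℝ, ℝ).prod I) (f := fun (p : ℝ × M) (y : M) => f p.1 y)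
    (b := fun p => p.2) (X := fun p => X p.2) (m := ∞) (n := ∞) (by simp) ?_
    ((hX x).comp (t, x) contMDiffAt_snd)
  exact (hf t ht x).comp ((t, x), x) (f := fun q : (ℝ × M) × M => (q.1.1, q.2))
    ((contMDiff_fst.comp contMDiff_fst).contMDiffAt.prodMk contMDiffAt_snd)

theorem hasDerivAt_mvfderiv [I.Boundaryless] [IsManifold I ∞ M] (hf : SmoothFamily I U f)
    (hU : U ∈ nhds t) (x : M) (v : TangentSpace I x) :
    HasDerivAt (fun s => mvfderiv I (f s) x v)
      (mvfderiv I (fun y => deriv (fun s => f s y) t) x v) t := by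
  have : IsManifold I 1 M := .of_le (n := ∞) (by simp)
  have ht := mem_of_mem_nhds hU
  have hsymm : ContMDiffAt 𝓘(ℝ, V) I ∞ (extChartAt I x).symm (extChartAt I x x) :=
    (contMDiffOn_extChartAt_symm x).contMDiffAt (extChartAt_target_mem_nhds x)
  have hf' : ContMDiffAt (𝓘(ℝ, ℝ).prod I) 𝓘(ℝ, F) ∞ (fun p : ℝ × M => f p.1 p.2)
      (t, (extChartAt I x).symm (extChartAt I x x)) := hf t ht _
  have hK := hf'.comp (t, extChartAt I x x)
    (f := fun p : ℝ × V => (p.1, (extChartAt I x).symm p.2))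
    (contMDiffAt_fst.prodMk (hsymm.comp (t, extChartAt I x x) contMDiffAt_snd))
  rw [← modelWithCornersSelf_prod, chartedSpaceSelf_prod] at hK
  rw [mvfderiv_eq_fderiv_comp_extChartAt_symm (hf.deriv.mdifferentiableAt ht x)]
  refine (hasDerivAt_fderiv_apply (K := fun p => f p.1 ((extChartAt I x).symm p.2))
    (hK.contDiffAt.of_le (by exact WithTop.coe_le_coe.2 le_top)) v).congr_of_eventuallyEq ?_
  filter_upwards [hU] with s hs
  exact mvfderiv_eq_fderiv_comp_extChartAt_symm (hf.mdifferentiableAt hs x) v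

protected theorem logDeriv [IsManifold I 1 M] {r : ℝ → M → ℝ} (hr : SmoothFamily I U r)
    (hr₀ : ∀ t ∈ U, ∀ x, r t x ≠ 0) : SmoothFamily I U (fun s x => logDeriv (fun τ => r τ x) s) :=
  fun t ht x => (hr.deriv t ht x).div₀ (hr t ht x) (hr₀ t ht x)

theorem hasDerivAt_integral [IsManifold I 1 M] [CompactSpace M] [MeasurableSpace M]
    [OpensMeasurableSpace M] [SecondCountableTopologyEither M F] (hf : SmoothFamily I U f)
    (hU : U ∈ nhds t) (μ : Measure M) [IsFiniteMeasure μ] :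
    HasDerivAt (fun s => ∫ x, f s x ∂μ) (∫ x, _root_.deriv (fun s => f s x) t ∂μ) t := by
  obtain ⟨K, hK, hKU, hKc⟩ := local_compact_nhds hU
  obtain ⟨C, hC⟩ := (hKc.prod isCompact_univ).exists_bound_of_continuousOn
    (hf.deriv.continuousOn.mono (prod_mono_left hKU))
  have ht := mem_of_mem_nhds hU
  have measurable {s : ℝ} (hs : s ∈ U) : AEStronglyMeasurable (f s) μ :=
    (hf.contMDiff hs).continuous.aestronglyMeasurable
  exact (hasDerivAt_integral_of_dominated_loc_of_deriv_le (bound := fun _ => C)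
    (F' := fun s x => _root_.deriv (fun s => f s x) s) hK
    (Filter.eventually_of_mem hU fun s hs => measurable hs)
    ((hf.contMDiff ht).continuous.integrable_of_hasCompactSupport (.of_compactSpace _))
    (hf.deriv.contMDiff ht).continuous.aestronglyMeasurable
    (.of_forall fun x s hs => hC (s, x) ⟨hs, mem_univ x⟩) (integrable_const C)
    (.of_forall fun x s hs => hf.hasDerivAt (hKU hs) x)).2

end SmoothFamily

end SmoothFamily

/-! ### Orthonormal frames and conformal change -/

/-- The connection coefficients `g(∇_{eₖ} eᵢ, eⱼ)` of an orthonormal frame, expressed by Koszul's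
formula through its structure functions `c i j k = g([eᵢ, eⱼ], eₖ)`. -/
def koszulCoeff (c : Fin 3 → Fin 3 → Fin 3 → ℝ) (k i j : Fin 3) : ℝ :=
  (1 / 2) * (c k i j - c i j k + c j k i)

section Koszul

variable {c : Fin 3 → Fin 3 → Fin 3 → ℝ}

theorem koszulCoeff_swap (hc : ∀ i j k, c i j k = -c j i k) (k i j : Fin 3) :
    koszulCoeff c k i j = -koszulCoeff c k j i := by
  rw [koszulCoeff, koszulCoeff, hc k i j, hc i j k, hc j k i]
  ring

theorem sum_koszulCoeff (hc : ∀ i j k, c i j k = -c j i k) (k : Fin 3) :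
    ∑ i, koszulCoeff c i k i = ∑ i, c i k i := by
  refine Finset.sum_congr rfl fun i _ => ?_
  rw [koszulCoeff, hc k i i, self_eq_neg.1 (hc i i k)]
  ring

end Koszul

theorem mlieBracket_smul_smul {V H : Type*} [NormedAddCommGroup V] [NormedSpace ℝ V]
    [CompleteSpace V] [TopologicalSpace H] {I : ModelWithCorners ℝ V H} {M : Type*}
    [TopologicalSpace M] [ChartedSpace H M] [IsManifold I 2 M] {f : M → ℝ}
    {X Y : ∀ x : M, TangentSpace I x} {x : M} (hf : MDifferentiableAt I 𝓘(ℝ, ℝ) f x)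
    (hX : MDifferentiableAt I I.tangent (fun y => (⟨y, X y⟩ : TangentBundle I M)) x)
    (hY : MDifferentiableAt I I.tangent (fun y => (⟨y, Y y⟩ : TangentBundle I M)) x) :
    VectorField.mlieBracket I (fun y => f y • X y) (fun y => f y • Y y) x
      = f x • (f x • VectorField.mlieBracket I X Y x + mvfderiv I f x (X x) • Y x
        - mvfderiv I f x (Y x) • X x) := by
  have left := VectorField.mlieBracket_smul_left (W := fun y => f y • Y y) hf hX
  have right := VectorField.mlieBracket_smul_right (V := X) hf hY
  refine left.trans ((congrArg _ (congrArg (f x • ·) right)).trans ?_)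
  rw [map_smul, smul_eq_mul]
  module

section Frame

variable {M : Type*} [TopologicalSpace M] [ChartedSpace Model M]

/-- The structure functions `g([eᵢ, eⱼ], eₖ)` of a frame. -/
def structureCoeff (g : FormField M) (e : Fin 3 → VField M) (x : M) (i j k : Fin 3) : ℝ :=
  g x (VectorField.mlieBracket (𝓡 3) (e i) (e j) x) (e k x)

/-- The conformal metric `r² g`. -/
def conformalMetric (r : M → ℝ) (g : FormField M) : FormField M :=
  fun x => r x ^ 2 • g x

/-- The frame `r⁻¹ eₖ`, which is orthonormal for `r² g` if `e` is so for `g`. -/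
def conformalFrame (r : M → ℝ) (e : Fin 3 → VField M) : Fin 3 → VField M :=
  fun k x => (r x)⁻¹ • e k x

theorem structureCoeff_swap (g : FormField M) (e : Fin 3 → VField M) (x : M) (i j k : Fin 3) :
    structureCoeff g e x i j k = -structureCoeff g e x j i k := by
  rw [structureCoeff, VectorField.mlieBracket_swap_apply, map_neg, _root_.neg_apply,
    structureCoeff]

theorem dirac_zero (g : FormField M) (e : Fin 3 → VField M) (x : M) :
    dirac g e (fun _ => 0) x = 0 := by
  simp [dirac, spinDeriv, mvfderiv_const]

variable [IsManifold (𝓡 3) ∞ M] {g : FormField M} {e : Fin 3 → VField M} {r : M → ℝ}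

/-- Smooth global frames which are orthonormal for `g`. -/
structure IsSmoothOrthonormalFrame (g : FormField M) (e : Fin 3 → VField M) : Prop where
  contMDiff (k : Fin 3) :
    ContMDiff (𝓡 3) (𝓡 3).tangent ∞ (fun x => (⟨x, e k x⟩ : TangentBundle (𝓡 3) M))
  apply_apply (x : M) (i j : Fin 3) : g x (e i x) (e j x) = if i = j then 1 else 0

namespace IsSmoothOrthonormalFrame

theorem mdifferentiableAt (he : IsSmoothOrthonormalFrame g e) (k : Fin 3) (x : M) :
    MDifferentiableAt (𝓡 3) (𝓡 3).tangent (fun y => (⟨y, e k y⟩ : TangentBundle (𝓡 3) M)) x :=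
  (he.contMDiff k).mdifferentiableAt (by simp)

theorem leviCivita_eq (he : IsSmoothOrthonormalFrame g e) (x : M) (k i j : Fin 3) :
    leviCivita g (e k) (e i) (e j) x = koszulCoeff (structureCoeff g e x) k i j := by
  simp only [leviCivita, koszulCoeff, structureCoeff, he.apply_apply, mvfderiv_const,
    _root_.zero_apply, sub_zero, add_zero, zero_add]

theorem dirac_eq (he : IsSmoothOrthonormalFrame g e) (φ : M → Spinor) (x : M) :
    dirac g e φ x = ∑ k, clifford k (mvfderiv (𝓡 3) φ x (e k x))
      + (1 / 4 : ℝ) • ∑ k, ∑ i, ∑ j, koszulCoeff (structureCoeff g e x) k i j •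
        clifford k (clifford i (clifford j (φ x))) := by
  simp only [dirac, spinDeriv, map_add, map_sum, clifford_real_smul, Finset.sum_add_distrib,
    Finset.smul_sum, he.leviCivita_eq]

theorem conformal (he : IsSmoothOrthonormalFrame g e)
    (hr : ContMDiff (𝓡 3) 𝓘(ℝ, ℝ) ∞ r) (hr₀ : ∀ x, r x ≠ 0) :
    IsSmoothOrthonormalFrame (conformalMetric r g) (conformalFrame r e) where
  contMDiff k := (hr.inv₀ hr₀).smul_section (he.contMDiff k)
  apply_apply x i j := by
    simp only [conformalMetric, conformalFrame, map_smul, _root_.smul_apply, he.apply_apply,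
      smul_eq_mul]
    have := hr₀ x
    split_ifs <;> field_simp

end IsSmoothOrthonormalFrame

theorem structureCoeff_conformal (he : IsSmoothOrthonormalFrame g e)
    (hr : ContMDiff (𝓡 3) 𝓘(ℝ, ℝ) ∞ r) (hr₀ : ∀ x, r x ≠ 0) (x : M) (k i j : Fin 3) :
    structureCoeff (conformalMetric r g) (conformalFrame r e) x k i j
      = (r x)⁻¹ * structureCoeff g e x k i j
        + (if i = j then mvfderiv (𝓡 3) (fun y => (r y)⁻¹) x (e k x) else 0)
        - (if k = j then mvfderiv (𝓡 3) (fun y => (r y)⁻¹) x (e i x) else 0) := by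
  have : IsManifold (𝓡 3) 2 M := .of_le (n := ∞) (by exact WithTop.coe_le_coe.2 le_top)
  have hinv : MDifferentiableAt (𝓡 3) 𝓘(ℝ, ℝ) (fun y => (r y)⁻¹) x :=
    (hr.inv₀ hr₀).mdifferentiableAt (by simp)
  have := hr₀ x
  have bracket := mlieBracket_smul_smul hinv (he.mdifferentiableAt k x) (he.mdifferentiableAt i x)
  rw [structureCoeff]
  change conformalMetric r g x (VectorField.mlieBracket (𝓡 3) (fun y => (r y)⁻¹ • e k y)
    (fun y => (r y)⁻¹ • e i y) x) ((r x)⁻¹ • e j x) = _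
  rw [bracket]
  simp only [conformalMetric, structureCoeff, map_smul, map_add, map_sub, _root_.smul_apply,
    _root_.add_apply, _root_.sub_apply, smul_eq_mul, he.apply_apply]
  field_simp
  split_ifs <;> ring

theorem koszulCoeff_conformal (he : IsSmoothOrthonormalFrame g e)
    (hr : ContMDiff (𝓡 3) 𝓘(ℝ, ℝ) ∞ r) (hr₀ : ∀ x, r x ≠ 0) (x : M) (k i j : Fin 3) :
    koszulCoeff (structureCoeff (conformalMetric r g) (conformalFrame r e) x) k i j
      = (r x)⁻¹ * koszulCoeff (structureCoeff g e x) k i j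
        + ((if i = k then mvfderiv (𝓡 3) (fun y => (r y)⁻¹) x (e j x) else 0)
          - (if j = k then mvfderiv (𝓡 3) (fun y => (r y)⁻¹) x (e i x) else 0)) := by
  simp only [koszulCoeff, structureCoeff_conformal he hr hr₀, eq_comm (a := k),
    eq_comm (a := j) (b := i)]
  ring

theorem dirac_conformal (he : IsSmoothOrthonormalFrame g e)
    (hr : ContMDiff (𝓡 3) 𝓘(ℝ, ℝ) ∞ r) (hr₀ : ∀ x, r x ≠ 0) (φ : M → Spinor) (x : M) :
    dirac (conformalMetric r g) (conformalFrame r e) φ x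
      = (r x)⁻¹ • dirac g e φ x
        - ∑ k, mvfderiv (𝓡 3) (fun y => (r y)⁻¹) x (e k x) • clifford k (φ x) := by
  rw [(he.conformal hr hr₀).dirac_eq, he.dirac_eq]
  simp only [koszulCoeff_conformal he hr hr₀, conformalFrame, add_smul, Finset.sum_add_distrib,
    smul_add, sum_clifford_conformal (fun k => mvfderiv (𝓡 3) (fun y => (r y)⁻¹) x (e k x)),
    map_smul, clifford_real_smul, mul_smul, ← Finset.smul_sum]
  rw [smul_comm (1 / 4 : ℝ), sub_eq_add_neg, add_assoc]

end Frame

/-! ### Determinants, traces and Gram matrices -/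

section Alternating

variable {ι R V N : Type*} [DecidableEq ι] [CommRing R] [AddCommGroup V] [Module R V]
  [AddCommGroup N] [Module R N]

theorem map_update_basis [Finite ι] (f : V [⋀^ι]→ₗ[R] N) (b : Module.Basis ι R V) (i : ι) (w : V) :
    f (Function.update b i w) = b.repr w i • f b := by
  have := Fintype.ofFinite ι
  conv_lhs => rw [← b.sum_repr w]
  rw [f.map_update_sum, Finset.sum_eq_single i]
  · rw [f.map_update_smul, Function.update_eq_self]
  · intro j _ hj
    rw [f.map_update_smul, f.map_update_self _ hj.symm, smul_zero]
  · exact fun h => absurd (Finset.mem_univ i) h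

variable [Fintype ι]

theorem sum_map_update_basis (f : V [⋀^ι]→ₗ[R] N) (b : Module.Basis ι R V) (T : V →ₗ[R] V) :
    ∑ i, f (Function.update b i (T (b i))) = LinearMap.trace R V T • f b := by
  simp only [map_update_basis, ← Finset.sum_smul, LinearMap.trace_eq_matrix_trace R b,
    Matrix.trace, Matrix.diag_apply, LinearMap.toMatrix_apply]

theorem det_gram_eq_sq_det {B : V →ₗ[R] V →ₗ[R] R} (e : Module.Basis ι R V)
    (he : ∀ i j, B (e i) (e j) = if i = j then 1 else 0) (d : Module.Basis ι R V) :
    Matrix.det (Matrix.of fun i j => B (d i) (d j)) = e.det d ^ 2 := by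
  have hB : LinearMap.toMatrix₂ e e B = 1 := by
    ext i j
    rw [LinearMap.toMatrix₂_apply, he, Matrix.one_apply]
  have hd : (Matrix.of fun i j => B (d i) (d j)) = LinearMap.toMatrix₂ d d B := by
    ext i j
    rw [LinearMap.toMatrix₂_apply, Matrix.of_apply]
  rw [hd, ← LinearMap.toMatrix₂_mul_basis_toMatrix e e d d, hB, mul_one, Matrix.det_mul,
    Matrix.det_transpose, ← Module.Basis.det_apply, sq]

end Alternating

section DetForm

variable {ι V : Type*} [Fintype ι] [DecidableEq ι] [NormedAddCommGroup V] [NormedSpace ℝ V]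
  [FiniteDimensional ℝ V]

/-- The determinant in a basis of a finite-dimensional real space, as a continuous multilinear
form; this makes its derivatives available. -/
def detForm (b : Module.Basis ι ℝ V) : ContinuousMultilinearMap ℝ (fun _ : ι => V) ℝ where
  toMultilinearMap := b.det.toMultilinearMap
  cont := by
    change Continuous fun v : ι → V => b.det v
    simp only [b.det_apply]
    exact Continuous.matrix_det <| continuous_matrix fun i j =>
      (LinearMap.continuous_of_finiteDimensional (b.coord i)).comp (continuous_apply j)

end DetForm

/-! ### Frames in charts -/

section Chart

variable {M : Type*} [TopologicalSpace M] [ChartedSpace Model M]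

/-- The coordinate representation of a vector field in the preferred chart at `c`. -/
def chartField (X : VField M) (c : M) (y : Model) : Model :=
  VectorField.mpullback 𝓘(ℝ, Model) (𝓡 3) (extChartAt (𝓡 3) c).symm X y

/-- The determinant of the coordinate representation of a frame in the preferred chart at `c`. -/
def chartDet (e : Fin 3 → VField M) (c : M) (y : Model) : ℝ :=
  detForm (EuclideanSpace.basisFun (Fin 3) ℝ).toBasis fun k => chartField (e k) c y

theorem chartDensity_nonneg (g : FormField M) (c : M) (y : Model) : 0 ≤ chartDensity g c y :=
  Real.sqrt_nonneg _

variable [IsManifold (𝓡 3) ∞ M] {c : M} {y : Model} {X Y : VField M}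

theorem contMDiffAt_extChartAt_symm (hy : y ∈ (extChartAt (𝓡 3) c).target) :
    ContMDiffAt 𝓘(ℝ, Model) (𝓡 3) ∞ (extChartAt (𝓡 3) c).symm y :=
  (contMDiffOn_extChartAt_symm c).contMDiffAt ((isOpen_extChartAt_target c).mem_nhds hy)

theorem isInvertible_mfderiv_extChartAt_symm (hy : y ∈ (extChartAt (𝓡 3) c).target) :
    (mfderiv 𝓘(ℝ, Model) (𝓡 3) (extChartAt (𝓡 3) c).symm y).IsInvertible := by
  have h := isInvertible_mfderivWithin_extChartAt_symm (I := 𝓡 3) hy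
  rwa [(𝓡 3).range_eq_univ, mfderivWithin_univ] at h

theorem mfderiv_chartField (X : VField M) (hy : y ∈ (extChartAt (𝓡 3) c).target) :
    mfderiv 𝓘(ℝ, Model) (𝓡 3) (extChartAt (𝓡 3) c).symm y (chartField X c y)
      = X ((extChartAt (𝓡 3) c).symm y) :=
  (isInvertible_mfderiv_extChartAt_symm hy).self_apply_inverse _

theorem contDiffAt_chartField
    (hX : ContMDiff (𝓡 3) (𝓡 3).tangent ∞ (fun x => (⟨x, X x⟩ : TangentBundle (𝓡 3) M)))
    (hy : y ∈ (extChartAt (𝓡 3) c).target) : ContDiffAt ℝ ∞ (chartField X c) y :=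
  contMDiffAt_vectorSpace_iff_contDiffAt.1
    (ContMDiffAt.mpullback_vectorField_preimage (n := ∞) (hX _) (contMDiffAt_extChartAt_symm hy)
      (isInvertible_mfderiv_extChartAt_symm hy) (by simp))

theorem fderiv_chartField {F : Type*} [NormedAddCommGroup F] [NormedSpace ℝ F] {f : M → F}
    (X : VField M) (hy : y ∈ (extChartAt (𝓡 3) c).target)
    (hf : MDifferentiableAt (𝓡 3) 𝓘(ℝ, F) f ((extChartAt (𝓡 3) c).symm y)) :
    fderiv ℝ (fun z => f ((extChartAt (𝓡 3) c).symm z)) y (chartField X c y)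
      = mvfderiv (𝓡 3) f ((extChartAt (𝓡 3) c).symm y) (X ((extChartAt (𝓡 3) c).symm y)) := by
  have chain := (HasMFDerivAt.comp y hf.hasMFDerivAt
    ((contMDiffAt_extChartAt_symm hy).mdifferentiableAt (by simp)).hasMFDerivAt).mfderiv
  rw [mfderiv_eq_fderiv] at chain
  rw [← mfderiv_chartField X hy]
  exact congrArg (fun A : Model →L[ℝ] F => A (chartField X c y)) chain

theorem lieBracket_chartField
    (hX : ContMDiff (𝓡 3) (𝓡 3).tangent ∞ (fun x => (⟨x, X x⟩ : TangentBundle (𝓡 3) M)))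
    (hY : ContMDiff (𝓡 3) (𝓡 3).tangent ∞ (fun x => (⟨x, Y x⟩ : TangentBundle (𝓡 3) M)))
    (hy : y ∈ (extChartAt (𝓡 3) c).target) :
    VectorField.lieBracket ℝ (chartField X c) (chartField Y c) y
      = chartField (VectorField.mlieBracket (𝓡 3) X Y) c y := by
  have : IsManifold (𝓡 3) (minSmoothness ℝ 3) M := by
    rw [minSmoothness_of_isRCLikeNormedField]
    exact .of_le (n := ∞) (by exact WithTop.coe_le_coe.2 le_top)
  rw [chartField, VectorField.mpullback_mlieBracket (I := 𝓘(ℝ, Model)) (n := ∞)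
    ((hX _).mdifferentiableAt (by simp)) ((hY _).mdifferentiableAt (by simp))
    (contMDiffAt_extChartAt_symm hy)
    (by rw [minSmoothness_of_isRCLikeNormedField]; exact WithTop.coe_le_coe.2 le_top)]
  rw [← VectorField.mlieBracketWithin_univ, VectorField.mlieBracketWithin_eq_lieBracketWithin]
  exact (congrFun VectorField.lieBracketWithin_univ y).symm

end Chart

section FrameBasis

variable {M : Type*} [TopologicalSpace M] [ChartedSpace Model M] [IsManifold (𝓡 3) ∞ M]
  {g : FormField M} {e : Fin 3 → VField M} {X : VField M} {c : M} {y : Model}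

namespace IsSmoothOrthonormalFrame

theorem linearIndependent (he : IsSmoothOrthonormalFrame g e) (x : M) :
    LinearIndependent ℝ fun k => e k x :=
  Fintype.linearIndependent_iff.2 fun a ha k => by
    simpa [map_sum, he.apply_apply] using congrArg (fun v => g x v (e k x)) ha

/-- The basis of the tangent space at a point given by an orthonormal frame. -/
def basis (he : IsSmoothOrthonormalFrame g e) (x : M) :
    Module.Basis (Fin 3) ℝ (TangentSpace (𝓡 3) x) :=
  basisOfLinearIndependentOfCardEqFinrank (he.linearIndependent x)
    (finrank_euclideanSpace_fin (𝕜 := ℝ) (n := 3)).symm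

theorem basis_apply (he : IsSmoothOrthonormalFrame g e) (x : M) (k : Fin 3) :
    he.basis x k = e k x :=
  congrFun (coe_basisOfLinearIndependentOfCardEqFinrank _ _) k

theorem basis_repr (he : IsSmoothOrthonormalFrame g e) (x : M) (v : TangentSpace (𝓡 3) x)
    (k : Fin 3) : (he.basis x).repr v k = g x v (e k x) := by
  conv_rhs => rw [← (he.basis x).sum_repr v]
  simp [map_sum, he.basis_apply, he.apply_apply]

theorem exists_basis_chartField (he : IsSmoothOrthonormalFrame g e)
    (hy : y ∈ (extChartAt (𝓡 3) c).target) :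
    ∃ b : Module.Basis (Fin 3) ℝ Model, (b : Fin 3 → Model) = (fun k => chartField (e k) c y) ∧
      ∀ X k, b.repr (chartField X c y) k = g ((extChartAt (𝓡 3) c).symm y)
        (X ((extChartAt (𝓡 3) c).symm y)) (e k ((extChartAt (𝓡 3) c).symm y)) := by
  obtain ⟨A, hA⟩ : ∃ A : Model ≃L[ℝ] TangentSpace (𝓡 3) ((extChartAt (𝓡 3) c).symm y),
      ∀ X : VField M, A (chartField X c y) = X ((extChartAt (𝓡 3) c).symm y) := by
    obtain ⟨A, hA⟩ := isInvertible_mfderiv_extChartAt_symm hy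
    refine ⟨A, fun X => ?_⟩
    rw [← mfderiv_chartField X hy, ← hA]
    rfl
  refine ⟨(he.basis _).map A.symm.toLinearEquiv, funext fun k => A.injective ?_, fun X k => ?_⟩
  · rw [hA, ← he.basis_apply]
    exact A.apply_symm_apply _
  · rw [← he.basis_repr, ← hA X]
    rfl

theorem chartDet_ne_zero (he : IsSmoothOrthonormalFrame g e)
    (hy : y ∈ (extChartAt (𝓡 3) c).target) : chartDet e c y ≠ 0 := by
  obtain ⟨b, hb, -⟩ := he.exists_basis_chartField hy
  rw [chartDet, ← hb]
  exact ((EuclideanSpace.basisFun (Fin 3) ℝ).toBasis.isUnit_det b).ne_zero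

theorem detForm_update_chartField (he : IsSmoothOrthonormalFrame g e)
    (hy : y ∈ (extChartAt (𝓡 3) c).target) (X : VField M) (i : Fin 3) :
    detForm (EuclideanSpace.basisFun (Fin 3) ℝ).toBasis
        (Function.update (fun k => chartField (e k) c y) i (chartField X c y))
      = g ((extChartAt (𝓡 3) c).symm y) (X ((extChartAt (𝓡 3) c).symm y))
          (e i ((extChartAt (𝓡 3) c).symm y)) * chartDet e c y := by
  obtain ⟨b, hb, hrepr⟩ := he.exists_basis_chartField hy
  rw [chartDet, ← hb, ← hrepr]
  exact map_update_basis _ b i _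

theorem contDiffAt_chartDet (he : IsSmoothOrthonormalFrame g e)
    (hy : y ∈ (extChartAt (𝓡 3) c).target) : ContDiffAt ℝ ∞ (chartDet e c) y :=
  (detForm _).contDiff.contDiffAt.comp y
    (contDiffAt_pi.2 fun k => contDiffAt_chartField (he.contMDiff k) hy)

/-- By Cramer's rule the components of `X` are quotients of smooth determinants. -/
theorem contMDiff_apply (he : IsSmoothOrthonormalFrame g e)
    (hX : ContMDiff (𝓡 3) (𝓡 3).tangent ∞ (fun x => (⟨x, X x⟩ : TangentBundle (𝓡 3) M)))
    (k : Fin 3) : ContMDiff (𝓡 3) 𝓘(ℝ, ℝ) ∞ (fun x => g x (X x) (e k x)) := by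
  intro x
  have hx : extChartAt (𝓡 3) x x ∈ (extChartAt (𝓡 3) x).target := mem_extChartAt_target x
  have hfields : ContDiffAt ℝ ∞ (fun y =>
      Function.update (fun i => chartField (e i) x y) k (chartField X x y))
      (extChartAt (𝓡 3) x x) := by
    refine contDiffAt_pi.2 fun i => ?_
    rcases eq_or_ne i k with rfl | hik
    · simpa only [Function.update_self] using contDiffAt_chartField hX hx
    · simpa only [Function.update_of_ne hik] using contDiffAt_chartField (he.contMDiff i) hx
  have hquot := ((detForm (EuclideanSpace.basisFun (Fin 3) ℝ).toBasis).contDiff.contDiffAt.comp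
    (extChartAt (𝓡 3) x x) hfields).div (he.contDiffAt_chartDet hx) (he.chartDet_ne_zero hx)
  refine (hquot.contMDiffAt.comp x contMDiffAt_extChartAt).congr_of_eventuallyEq ?_
  filter_upwards [extChartAt_source_mem_nhds (I := 𝓡 3) x] with z hz
  have hz' := (extChartAt (𝓡 3) x).map_source hz
  have hcramer := he.detForm_update_chartField hz' X k
  rw [(extChartAt (𝓡 3) x).left_inv hz] at hcramer
  exact eq_div_of_mul_eq (he.chartDet_ne_zero hz') hcramer.symm

theorem contMDiff_structureCoeff (he : IsSmoothOrthonormalFrame g e) (i j k : Fin 3) :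
    ContMDiff (𝓡 3) 𝓘(ℝ, ℝ) ∞ (fun x => structureCoeff g e x i j k) := by
  have manifold_of_le {n : WithTop ℕ∞} (hn : n ≤ ∞) : IsManifold (𝓡 3) n M := .of_le hn
  have : IsManifold (𝓡 3) (minSmoothness ℝ 2) M := manifold_of_le <| by
    rw [minSmoothness_of_isRCLikeNormedField]
    exact WithTop.coe_le_coe.2 le_top
  have : IsManifold (𝓡 3) (minSmoothness ℝ 3) M := manifold_of_le <| by
    rw [minSmoothness_of_isRCLikeNormedField]
    exact WithTop.coe_le_coe.2 le_top
  have : IsManifold (𝓡 3) ((⊤ : ℕ∞) + 1) M := manifold_of_le le_rfl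
  exact he.contMDiff_apply (X := VectorField.mlieBracket (𝓡 3) (e i) (e j))
    (fun x => ContMDiffAt.mlieBracket_vectorField (n := ⊤) (m := ⊤) (he.contMDiff i x)
      (he.contMDiff j x) (by simp)) k

/-- The matrix of the frame in the coordinate basis is inverse to that of the coordinate basis in
the frame, whose square has the Gram matrix of the coordinate basis as determinant. -/
theorem chartDensity_eq (he : IsSmoothOrthonormalFrame g e)
    (hy : y ∈ (extChartAt (𝓡 3) c).target) : chartDensity g c y = |chartDet e c y|⁻¹ := by
  obtain ⟨b, hb, -⟩ := he.exists_basis_chartField hy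
  let L : Model →L[ℝ] TangentSpace (𝓡 3) ((extChartAt (𝓡 3) c).symm y) :=
    mfderiv 𝓘(ℝ, Model) (𝓡 3) (extChartAt (𝓡 3) c).symm y
  have hB (i j : Fin 3) : (g ((extChartAt (𝓡 3) c).symm y)).toLinearMap₁₂.compl₁₂
      L.toLinearMap L.toLinearMap (b i) (b j)
      = if i = j then 1 else 0 := by
    rw [hb, ← he.apply_apply ((extChartAt (𝓡 3) c).symm y), ← mfderiv_chartField (e i) hy,
      ← mfderiv_chartField (e j) hy]
    rfl
  have hgram : chartDensity g c y
      = √(b.det (EuclideanSpace.basisFun (Fin 3) ℝ).toBasis ^ 2) := by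
    rw [← det_gram_eq_sq_det b hB]
    simp only [OrthonormalBasis.coe_toBasis, EuclideanSpace.basisFun_apply]
    rfl
  have hinv : chartDet e c y * b.det (EuclideanSpace.basisFun (Fin 3) ℝ).toBasis = 1 := by
    rw [chartDet, ← hb, ← (EuclideanSpace.basisFun (Fin 3) ℝ).toBasis.det_self]
    exact Module.Basis.det_mul_det _ b _
  rw [hgram, Real.sqrt_sq_eq_abs, ← abs_inv, eq_inv_of_mul_eq_one_right hinv]

theorem chartDensity_eventuallyEq (he : IsSmoothOrthonormalFrame g e)
    (hy : y ∈ (extChartAt (𝓡 3) c).target) :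
    chartDensity g c =ᶠ[nhds y] fun z => |chartDet e c z|⁻¹ := by
  filter_upwards [(isOpen_extChartAt_target c).mem_nhds hy] with z hz
  exact he.chartDensity_eq hz

theorem contDiffAt_chartDensity (he : IsSmoothOrthonormalFrame g e)
    (hy : y ∈ (extChartAt (𝓡 3) c).target) : ContDiffAt ℝ ∞ (chartDensity g c) y :=
  (((contDiffAt_abs (he.chartDet_ne_zero hy)).comp y (he.contDiffAt_chartDet hy)).inv
    (abs_ne_zero.2 (he.chartDet_ne_zero hy))).congr_of_eventuallyEq
      (he.chartDensity_eventuallyEq hy)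

end IsSmoothOrthonormalFrame

end FrameBasis

section Transition

variable {M : Type*} [TopologicalSpace M] [ChartedSpace Model M] [IsManifold (𝓡 3) ∞ M]
  {g : FormField M} {e : Fin 3 → VField M} {c c' x : M} {y : Model}

/-- The coordinate change from the preferred chart at `c` to the one at `c'`. -/
def transition (c c' : M) : PartialEquiv Model Model :=
  (extChartAt (𝓡 3) c).symm.trans (extChartAt (𝓡 3) c')

theorem mdifferentiableAt_extChartAt_of_mem (hx : x ∈ (extChartAt (𝓡 3) c).source) :
    MDifferentiableAt (𝓡 3) 𝓘(ℝ, Model) (extChartAt (𝓡 3) c) x :=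
  mdifferentiableAt_extChartAt (by rwa [extChartAt_source] at hx)

theorem differentiableAt_transition (hy : y ∈ (transition c c').source) :
    DifferentiableAt ℝ (transition c c') y :=
  ((mdifferentiableAt_extChartAt_of_mem hy.2).comp y
    ((contMDiffAt_extChartAt_symm hy.1).mdifferentiableAt (by simp))).differentiableAt

theorem mvfderiv_extChartAt (X : VField M) (hx : x ∈ (extChartAt (𝓡 3) c).source) :
    mvfderiv (𝓡 3) (extChartAt (𝓡 3) c) x (X x) = chartField X c (extChartAt (𝓡 3) c x) := by
  have hy := (extChartAt (𝓡 3) c).map_source hx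
  have hleft := (extChartAt (𝓡 3) c).left_inv hx
  have hid : (fun z => extChartAt (𝓡 3) c ((extChartAt (𝓡 3) c).symm z))
      =ᶠ[nhds (extChartAt (𝓡 3) c x)] id := by
    filter_upwards [(isOpen_extChartAt_target c).mem_nhds hy] with z hz
    exact (extChartAt (𝓡 3) c).right_inv hz
  have h := fderiv_chartField X hy
    (mdifferentiableAt_extChartAt_of_mem ((extChartAt (𝓡 3) c).map_target hy))
  rw [hid.fderiv_eq, fderiv_id, hleft] at h
  exact h.symm

theorem fderiv_transition_chartField (X : VField M) (hy : y ∈ (transition c c').source) :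
    fderiv ℝ (transition c c') y (chartField X c y) = chartField X c' (transition c c' y) :=
  (fderiv_chartField X hy.1 (mdifferentiableAt_extChartAt_of_mem hy.2)).trans
    (mvfderiv_extChartAt X hy.2)

theorem chartDet_transition (e : Fin 3 → VField M) (hy : y ∈ (transition c c').source) :
    chartDet e c' (transition c c' y) = (fderiv ℝ (transition c c') y).det * chartDet e c y := by
  simp only [chartDet, ← fderiv_transition_chartField _ hy]
  exact Module.Basis.det_comp _ _ _

theorem IsSmoothOrthonormalFrame.chartDensity_transition (he : IsSmoothOrthonormalFrame g e)
    (hy : y ∈ (transition c c').source) :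
    |(fderiv ℝ (transition c c') y).det| * chartDensity g c' (transition c c' y)
      = chartDensity g c y := by
  have hy' : transition c c' y ∈ (extChartAt (𝓡 3) c').target :=
    (extChartAt (𝓡 3) c').map_source hy.2
  have hdet := he.chartDet_ne_zero hy'
  rw [he.chartDensity_eq hy.1, he.chartDensity_eq hy']
  rw [chartDet_transition e hy] at hdet ⊢
  rw [abs_mul, mul_inv, mul_inv_cancel_left₀ (abs_ne_zero.2 (left_ne_zero_of_mul hdet))]

theorem IsSmoothOrthonormalFrame.continuousOn_chartDensity
    (he : IsSmoothOrthonormalFrame g e) (c : M) :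
    ContinuousOn (chartDensity g c) (extChartAt (𝓡 3) c).target := fun _ hy =>
  (he.contDiffAt_chartDensity hy).continuousAt.continuousWithinAt

theorem IsSmoothOrthonormalFrame.aemeasurable_chartDensity
    (he : IsSmoothOrthonormalFrame g e) (c : M) :
    AEMeasurable (fun y => ENNReal.ofReal (chartDensity g c y))
      (volume.restrict (extChartAt (𝓡 3) c).target) :=
  ((he.continuousOn_chartDensity c).aemeasurable
    (isOpen_extChartAt_target c).measurableSet).ennreal_ofReal

end Transition

/-! ### The Riemannian volume -/

section ChartVolume

variable {M : Type*} [TopologicalSpace M] [ChartedSpace Model M] [MeasurableSpace M] [BorelSpace M]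
  {g : FormField M} {e : Fin 3 → VField M}

theorem aemeasurable_extChartAt_symm (c : M) :
    AEMeasurable (extChartAt (𝓡 3) c).symm (volume.restrict (extChartAt (𝓡 3) c).target) :=
  (continuousOn_extChartAt_symm c).aemeasurable (isOpen_extChartAt_target c).measurableSet

theorem aemeasurable_extChartAt_symm_withDensity (c : M) (w : Model → ENNReal) :
    AEMeasurable (extChartAt (𝓡 3) c).symm
      ((volume.restrict (extChartAt (𝓡 3) c).target).withDensity w) :=
  (aemeasurable_extChartAt_symm c).mono_ac (withDensity_absolutelyContinuous _ _)

theorem chartVolume_apply_of_subset (g : FormField M) {c : M} {S : Set M} (hS : MeasurableSet S)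
    (hSc : S ⊆ (extChartAt (𝓡 3) c).source) :
    chartVolume g c S
      = ∫⁻ y in extChartAt (𝓡 3) c '' S, ENNReal.ofReal (chartDensity g c y) := by
  rw [chartVolume, Measure.map_apply_of_aemeasurable
    (aemeasurable_extChartAt_symm_withDensity c _) hS, withDensity_apply',
    Measure.restrict_restrict' (isOpen_extChartAt_target c).measurableSet,
    (extChartAt (𝓡 3) c).image_eq_target_inter_inv_preimage hSc, inter_comm]

theorem chartVolume_restrict_source (g : FormField M) (c : M) :
    (chartVolume g c).restrict (extChartAt (𝓡 3) c).source = chartVolume g c := by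
  refine Measure.restrict_eq_self_of_ae_mem
    ((ae_map_iff (aemeasurable_extChartAt_symm_withDensity c _)
      (isOpen_extChartAt_source c).measurableSet).2 ?_)
  refine (withDensity_absolutelyContinuous _ _).ae_le ?_
  filter_upwards [ae_restrict_mem (isOpen_extChartAt_target c).measurableSet] with y hy
  exact (extChartAt (𝓡 3) c).map_target hy

theorem measurableSet_image_extChartAt {c : M} {S : Set M} (hS : MeasurableSet S)
    (hSc : S ⊆ (extChartAt (𝓡 3) c).source) : MeasurableSet (extChartAt (𝓡 3) c '' S) := by
  rw [(extChartAt (𝓡 3) c).image_eq_target_inter_inv_preimage hSc, ← Subtype.image_preimage_coe]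
  exact (isOpen_extChartAt_target (I := 𝓡 3) c).measurableSet.subtype_image
    ((continuousOn_extChartAt_symm c).domRestrict.measurable hS)

end ChartVolume

namespace IsSmoothOrthonormalFrame

variable {M : Type*} [TopologicalSpace M] [ChartedSpace Model M] [IsManifold (𝓡 3) ∞ M]
  [MeasurableSpace M] [BorelSpace M] {g : FormField M} {e : Fin 3 → VField M}

theorem chartVolume_eq_of_subset (he : IsSmoothOrthonormalFrame g e) {c c' : M} {S : Set M}
    (hS : MeasurableSet S) (hSc : S ⊆ (extChartAt (𝓡 3) c).source)
    (hSc' : S ⊆ (extChartAt (𝓡 3) c').source) : chartVolume g c S = chartVolume g c' S := by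
  have himage : extChartAt (𝓡 3) c' '' S = transition c c' '' (extChartAt (𝓡 3) c '' S) := by
    rw [image_image]
    exact image_congr fun x hx =>
      (congrArg (extChartAt (𝓡 3) c') ((extChartAt (𝓡 3) c).left_inv (hSc hx))).symm
  have hsource : extChartAt (𝓡 3) c '' S ⊆ (transition c c').source := by
    rintro _ ⟨x, hx, rfl⟩
    refine ⟨(extChartAt (𝓡 3) c).map_source (hSc hx), ?_⟩
    rw [mem_preimage, (extChartAt (𝓡 3) c).symm_symm, (extChartAt (𝓡 3) c).left_inv (hSc hx)]
    exact hSc' hx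
  have hmeas := measurableSet_image_extChartAt hS hSc
  rw [chartVolume_apply_of_subset g hS hSc, chartVolume_apply_of_subset g hS hSc', himage,
    lintegral_image_eq_lintegral_abs_det_fderiv_mul volume hmeas
      (fun y hy => (differentiableAt_transition (hsource hy)).hasFDerivAt.hasFDerivWithinAt)
      ((transition c c').injOn.mono hsource)]
  refine setLIntegral_congr_fun hmeas fun y hy => ?_
  rw [← ENNReal.ofReal_mul (abs_nonneg _), he.chartDensity_transition (hsource hy)]

theorem chartVolume_restrict_le (he : IsSmoothOrthonormalFrame g e) (c c' : M) :
    (chartVolume g c').restrict (extChartAt (𝓡 3) c).source ≤ chartVolume g c := by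
  have hsource (z : M) := (isOpen_extChartAt_source (I := 𝓡 3) z).measurableSet
  refine Measure.le_iff.2 fun S hS => ?_
  rw [← chartVolume_restrict_source g c', Measure.restrict_restrict (hsource c),
    Measure.restrict_apply hS, he.chartVolume_eq_of_subset
      (hS.inter ((hsource c).inter (hsource c'))) (fun _ hx => hx.2.2) fun _ hx => hx.2.1]
  exact measure_mono inter_subset_left

theorem volumeMeasure_restrict_source (he : IsSmoothOrthonormalFrame g e) (c : M) :
    (volumeMeasure g).restrict (extChartAt (𝓡 3) c).source = chartVolume g c := by
  have hmeas := (isOpen_extChartAt_source (I := 𝓡 3) c).measurableSet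
  refine le_antisymm ?_ ?_
  · have hle : volumeMeasure g ≤
        chartVolume g c + (volumeMeasure g).restrict (extChartAt (𝓡 3) c).sourceᶜ := by
      refine iSup_le fun c' => ?_
      rw [← Measure.restrict_add_restrict_compl (μ := chartVolume g c') hmeas]
      exact add_le_add (he.chartVolume_restrict_le c c')
        (Measure.restrict_mono_measure (le_iSup (chartVolume g) c') _)
    refine (Measure.restrict_mono_measure hle _).trans_eq ?_
    rw [Measure.restrict_add, Measure.restrict_restrict hmeas, inter_compl_self,
      Measure.restrict_empty, add_zero, chartVolume_restrict_source]
  · rw [← chartVolume_restrict_source]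
    exact Measure.restrict_mono_measure (le_iSup (chartVolume g) c) _

theorem isLocallyFiniteMeasure_volumeMeasure [T2Space M] (he : IsSmoothOrthonormalFrame g e) :
    IsLocallyFiniteMeasure (volumeMeasure g) := by
  have := ChartedSpace.locallyCompactSpace Model M
  refine ⟨fun x => ?_⟩
  obtain ⟨K, hKx, hKs, hK⟩ := local_compact_nhds (extChartAt_source_mem_nhds (I := 𝓡 3) x)
  refine ⟨K, hKx, ?_⟩
  rw [← Measure.restrict_eq_self _ hKs, he.volumeMeasure_restrict_source,
    chartVolume_apply_of_subset g hK.measurableSet hKs]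
  have hcompact : IsCompact (extChartAt (𝓡 3) x '' K) :=
    hK.image_of_continuousOn ((continuousOn_extChartAt x).mono hKs)
  have hint : IntegrableOn (chartDensity g x) (extChartAt (𝓡 3) x '' K) :=
    ((he.continuousOn_chartDensity x).mono
      ((image_mono hKs).trans
        (extChartAt (𝓡 3) x).image_source_eq_target.subset)).integrableOn_compact hcompact
  exact hint.lintegral_lt_top

theorem lintegral_chartVolume (he : IsSmoothOrthonormalFrame g e) (c : M) {f : M → ENNReal}
    (hf : Measurable f) :
    ∫⁻ x, f x ∂(chartVolume g c) = ∫⁻ y in (extChartAt (𝓡 3) c).target,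
      ENNReal.ofReal (chartDensity g c y) * f ((extChartAt (𝓡 3) c).symm y) := by
  rw [chartVolume, lintegral_map' hf.aemeasurable (aemeasurable_extChartAt_symm_withDensity c _)]
  exact lintegral_withDensity_eq_lintegral_mul₀ (he.aemeasurable_chartDensity c)
    (hf.comp_aemeasurable (aemeasurable_extChartAt_symm c))

theorem integral_chartVolume (he : IsSmoothOrthonormalFrame g e) (c : M) {f : M → ℝ}
    (hf : Measurable f) :
    ∫ x, f x ∂(chartVolume g c) = ∫ y in (extChartAt (𝓡 3) c).target,
      chartDensity g c y * f ((extChartAt (𝓡 3) c).symm y) := by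
  rw [chartVolume, integral_map (aemeasurable_extChartAt_symm_withDensity c _)
    hf.aestronglyMeasurable, integral_withDensity_eq_integral_toReal_smul₀
      (he.aemeasurable_chartDensity c) (by simp)]
  simp only [ENNReal.toReal_ofReal (chartDensity_nonneg g c _), smul_eq_mul]

end IsSmoothOrthonormalFrame

section Conformal

variable {M : Type*} [TopologicalSpace M] [ChartedSpace Model M] {g : FormField M}
  {e : Fin 3 → VField M} {r : M → ℝ}

theorem chartDensity_conformal (g : FormField M) (hr : ∀ x, 0 ≤ r x) (c : M) (y : Model) :
    chartDensity (conformalMetric r g) c y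
      = r ((extChartAt (𝓡 3) c).symm y) ^ 3 * chartDensity g c y := by
  have hr₀ := hr ((extChartAt (𝓡 3) c).symm y)
  simp only [chartDensity, conformalMetric]
  rw [← Real.sqrt_sq (pow_nonneg hr₀ 3), ← Real.sqrt_mul (sq_nonneg _), pow_right_comm]
  exact congrArg Real.sqrt (Matrix.det_smul _ _)

theorem IsSmoothOrthonormalFrame.volumeMeasure_conformal [IsManifold (𝓡 3) ∞ M]
    [SigmaCompactSpace M] [MeasurableSpace M] [BorelSpace M]
    (he : IsSmoothOrthonormalFrame g e) (hr : ContMDiff (𝓡 3) 𝓘(ℝ, ℝ) ∞ r) (hr₀ : ∀ x, 0 < r x) :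
    volumeMeasure (conformalMetric r g)
      = (volumeMeasure g).withDensity fun x => ENNReal.ofReal (r x ^ 3) := by
  obtain ⟨s, hs, hcover⟩ := countable_cover_nhds_of_sigmaCompact
    fun x : M => extChartAt_source_mem_nhds (I := 𝓡 3) x
  have he' := he.conformal hr fun x => (hr₀ x).ne'
  have hdens : Measurable fun x => ENNReal.ofReal (r x ^ 3) :=
    (hr.continuous.measurable.pow_const 3).ennreal_ofReal
  refine (Measure.ext_iff_of_biUnion_eq_univ hs hcover).2 fun c _ => ?_
  rw [he'.volumeMeasure_restrict_source, restrict_withDensity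
    (isOpen_extChartAt_source c).measurableSet, he.volumeMeasure_restrict_source]
  ext S hS
  rw [← lintegral_indicator_one hS, he'.lintegral_chartVolume c (measurable_one.indicator hS),
    withDensity_apply _ hS, ← lintegral_indicator hS,
    he.lintegral_chartVolume c (hdens.indicator hS)]
  refine lintegral_congr fun y => ?_
  rw [chartDensity_conformal g fun x => (hr₀ x).le, mul_comm (r _ ^ 3),
    ENNReal.ofReal_mul (chartDensity_nonneg g c y), mul_assoc]
  congr 1
  rw [← indicator_mul_right S fun x => ENNReal.ofReal (r x ^ 3)]
  simp only [Pi.one_apply, mul_one]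

end Conformal

/-! ### The divergence theorem -/

section Flat

variable {V : Type*} [NormedAddCommGroup V] [NormedSpace ℝ V] {q : V → V} {U K : Set V}

theorem contDiff_indicator_of_eq_zero_off_isClosed {F : Type*} [NormedAddCommGroup F]
    [NormedSpace ℝ F] {n : WithTop ℕ∞} {f : V → F} (hU : IsOpen U) (hK : IsClosed K) (hKU : K ⊆ U)
    (hf : ∀ y ∈ U, ContDiffAt ℝ n f y) (hf₀ : ∀ y ∈ U, y ∉ K → f y = 0) :
    ContDiff ℝ n (U.indicator f) := by
  refine contDiff_iff_contDiffAt.2 fun y => ?_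
  by_cases hy : y ∈ U
  · refine (hf y hy).congr_of_eventuallyEq ?_
    filter_upwards [hU.mem_nhds hy] with z hz using indicator_of_mem hz f
  · refine contDiffAt_const (c := 0) |>.congr_of_eventuallyEq ?_
    filter_upwards [hK.isOpen_compl.mem_nhds fun hyK => hy (hKU hyK)] with z hz
    exact indicator_apply_eq_zero.2 fun hzU => hf₀ z hzU hz

variable [FiniteDimensional ℝ V]

theorem trace_fderiv_smul {w : V → ℝ} {y : V} (hw : DifferentiableAt ℝ w y)
    (hq : DifferentiableAt ℝ q y) :
    LinearMap.trace ℝ V (fderiv ℝ (fun z => w z • q z) y)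
      = fderiv ℝ w y (q y) + w y * LinearMap.trace ℝ V (fderiv ℝ q y) := by
  rw [fderiv_fun_smul hw hq, ContinuousLinearMap.toLinearMap_add, map_add, add_comm,
    ContinuousLinearMap.toLinearMap_smul, map_smul, smul_eq_mul]
  exact congrArg (· + _) (LinearMap.trace_smulRight _ _)

variable [MeasurableSpace V] [BorelSpace V] (μ : Measure V) [μ.IsAddHaarMeasure]

theorem integral_fderiv_apply_eq_zero {f : V → ℝ} (hf : ContDiff ℝ 1 f) (hfc : HasCompactSupport f)
    (v : V) : ∫ y, fderiv ℝ f y v ∂μ = 0 := by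
  have hint : Integrable (fun y => fderiv ℝ f y v) μ :=
    ((hf.continuous_fderiv one_ne_zero).clm_apply
      continuous_const).integrable_of_hasCompactSupport (hfc.fderiv_apply ℝ v)
  simpa using integral_mul_fderiv_eq_neg_fderiv_mul_of_integrable (μ := μ) (f := fun _ => (1 : ℝ))
    (g := f) (v := v) (by simp) (by simpa using hint)
    (by simpa using hf.continuous.integrable_of_hasCompactSupport hfc)
    (fun _ _ => differentiableAt_const _) (fun y _ => hf.differentiable one_ne_zero y)

theorem integral_trace_fderiv_eq_zero (hq : ContDiff ℝ 1 q) (hqc : HasCompactSupport q) :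
    ∫ y, LinearMap.trace ℝ V (fderiv ℝ q y) ∂μ = 0 := by
  let b := Module.finBasis ℝ V
  let coord (i) : V →L[ℝ] ℝ := (b.coord i).toContinuousLinearMap
  have hcoord (i) : ContDiff ℝ 1 fun y => coord i (q y) := (coord i).contDiff.comp hq
  have hcoordc (i) : HasCompactSupport fun y => coord i (q y) := hqc.comp_left (map_zero (coord i))
  have hderiv (i y) : fderiv ℝ (fun z => coord i (q z)) y (b i) = b.coord i (fderiv ℝ q y (b i)) :=
    congrArg (fun A : V →L[ℝ] ℝ => A (b i)) ((coord i).hasFDerivAt.comp y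
      (hq.differentiable one_ne_zero y).hasFDerivAt).fderiv
  have htrace (y) : LinearMap.trace ℝ V (fderiv ℝ q y)
      = ∑ i, fderiv ℝ (fun z => coord i (q z)) y (b i) := by
    simp only [hderiv, LinearMap.trace_eq_matrix_trace ℝ b, Matrix.trace, Matrix.diag_apply,
      LinearMap.toMatrix_apply]
    rfl
  simp only [htrace]
  rw [integral_finsetSum _ fun i _ => (((hcoord i).continuous_fderiv one_ne_zero).clm_apply
    continuous_const).integrable_of_hasCompactSupport ((hcoordc i).fderiv_apply ℝ _)]
  exact Finset.sum_eq_zero fun i _ => integral_fderiv_apply_eq_zero μ (hcoord i) (hcoordc i) _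

theorem setIntegral_trace_fderiv_eq_zero (hU : IsOpen U) (hK : IsCompact K) (hKU : K ⊆ U)
    (hq : ∀ y ∈ U, ContDiffAt ℝ 1 q y) (hq₀ : ∀ y ∈ U, y ∉ K → q y = 0) :
    ∫ y in U, LinearMap.trace ℝ V (fderiv ℝ q y) ∂μ = 0 := by
  have hoff (y) (hy : y ∉ K) : U.indicator q y = 0 :=
    indicator_apply_eq_zero.2 fun hyU => hq₀ y hyU hy
  have hQ := contDiff_indicator_of_eq_zero_off_isClosed hU hK.isClosed hKU hq hq₀
  rw [← integral_trace_fderiv_eq_zero μ hQ (HasCompactSupport.intro hK hoff),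
    ← setIntegral_eq_integral_of_forall_compl_eq_zero (s := U)
      (f := fun y => LinearMap.trace ℝ V (fderiv ℝ (U.indicator q) y))]
  · refine setIntegral_congr_fun hU.measurableSet fun y hy => ?_
    have hloc : q =ᶠ[nhds y] U.indicator q := by
      filter_upwards [hU.mem_nhds hy] with z hz using (indicator_of_mem hz q).symm
    rw [hloc.fderiv_eq]
  · intro y hy
    have hloc : U.indicator q =ᶠ[nhds y] fun _ => 0 := by
      filter_upwards [hK.isClosed.isOpen_compl.mem_nhds fun hyK => hy (hKU hyK)] with z hz
      exact hoff z hz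
    rw [hloc.fderiv_eq, fderiv_fun_const]
    exact map_zero _

theorem hasDerivAt_abs_inv {x : ℝ} (hx : x ≠ 0) :
    HasDerivAt (fun z : ℝ => |z|⁻¹) (-(|x|⁻¹ / x)) x := by
  have hsign : -(SignType.sign x : ℝ) / |x| ^ 2 = -(|x|⁻¹ / x) := by
    rcases hx.lt_or_gt with h | h
    · rw [sign_neg h, abs_of_neg h]
      simp [field]
    · rw [sign_pos h, abs_of_pos h]
      simp [field]
  exact ((hasDerivAt_abs hx).inv (abs_ne_zero.2 hx)).congr_deriv hsign

end Flat

section Divergence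

variable {M : Type*} [TopologicalSpace M] [ChartedSpace Model M] {g : FormField M}
  {e : Fin 3 → VField M} {f : M → ℝ} {c x : M} {y : Model} {k : Fin 3}

/-- The divergence of `f eₖ`, for an orthonormal frame `e`, through its structure coefficients. -/
def frameDivergence (g : FormField M) (e : Fin 3 → VField M) (k : Fin 3) (f : M → ℝ) (x : M) : ℝ :=
  mvfderiv (𝓡 3) f x (e k x) + f x * ∑ i, structureCoeff g e x i k i

theorem frameDivergence_eq_zero (g : FormField M) (e : Fin 3 → VField M) (k : Fin 3)
    (hx : x ∉ tsupport f) : frameDivergence g e k f x = 0 := by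
  have h : f =ᶠ[nhds x] fun _ => 0 := notMem_tsupport_iff_eventuallyEq.1 hx
  rw [frameDivergence, mvfderiv_congr_of_eventuallyEq h, mvfderiv_const, h.eq_of_nhds, zero_mul,
    add_zero]
  rfl

theorem frameDivergence_sum {ι : Type*} (s : Finset ι) {F : ι → M → ℝ}
    (hF : ∀ i ∈ s, MDifferentiableAt (𝓡 3) 𝓘(ℝ, ℝ) (F i) x) :
    frameDivergence g e k (∑ i ∈ s, F i) x = ∑ i ∈ s, frameDivergence g e k (F i) x := by
  simp only [frameDivergence]
  rw [mvfderiv_finsetSum hF, Finset.sum_apply, Finset.sum_add_distrib,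
    ← Finset.sum_mul, _root_.sum_apply]

variable [IsManifold (𝓡 3) ∞ M]

namespace IsSmoothOrthonormalFrame

theorem continuous_frameDivergence (he : IsSmoothOrthonormalFrame g e) (k : Fin 3)
    (hf : ContMDiff (𝓡 3) 𝓘(ℝ, ℝ) ∞ f) : Continuous (frameDivergence g e k f) := by
  have hderiv : ContMDiff (𝓡 3) 𝓘(ℝ, ℝ) ∞ fun x => mvfderiv (𝓡 3) f x (e k x) := fun x =>
    contMDiffAt_mvfderiv_apply (n := ∞) (m := ∞) le_rfl (f := fun _ : M => f) (b := id)
      (ContMDiffAt.comp (x, x) (hf x) contMDiffAt_snd) (he.contMDiff k x)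
  exact hderiv.continuous.add (hf.continuous.mul
    (continuous_finsetSum _ fun i _ => (he.contMDiff_structureCoeff i k i).continuous))

/-- Jacobi's formula for `det (a₁, a₂, a₃)` along `aₖ`, after replacing `D aᵢ (aₖ)` by
`D aₖ (aᵢ) - [aᵢ, aₖ]`. -/
theorem fderiv_chartDet_chartField (he : IsSmoothOrthonormalFrame g e)
    (hy : y ∈ (extChartAt (𝓡 3) c).target) (k : Fin 3) :
    fderiv ℝ (chartDet e c) y (chartField (e k) c y)
      = (LinearMap.trace ℝ Model (fderiv ℝ (chartField (e k) c) y)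
        - ∑ i, structureCoeff g e ((extChartAt (𝓡 3) c).symm y) i k i) * chartDet e c y := by
  have hfields (i) := (contDiffAt_chartField (he.contMDiff i) hy).differentiableAt (by simp)
  have hjacobi : fderiv ℝ (chartDet e c) y (chartField (e k) c y)
      = ∑ i, detForm (EuclideanSpace.basisFun (Fin 3) ℝ).toBasis
          (Function.update (fun j => chartField (e j) c y) i
            (fderiv ℝ (chartField (e i) c) y (chartField (e k) c y))) := by
    have hderiv := (HasFDerivAt.multilinear_comp
      (detForm (EuclideanSpace.basisFun (Fin 3) ℝ).toBasis)
      fun i => (hfields i).hasFDerivAt).fderiv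
    exact (congrArg (fun A : Model →L[ℝ] ℝ => A (chartField (e k) c y)) hderiv).trans
      (_root_.sum_apply _ _ _)
  have hbracket (i) : fderiv ℝ (chartField (e i) c) y (chartField (e k) c y)
      = fderiv ℝ (chartField (e k) c) y (chartField (e i) c y)
        - chartField (VectorField.mlieBracket (𝓡 3) (e i) (e k)) c y := by
    rw [← lieBracket_chartField (he.contMDiff i) (he.contMDiff k) hy, VectorField.lieBracket,
      sub_sub_cancel]
  obtain ⟨b, hb, -⟩ := he.exists_basis_chartField hy
  have htrace := sum_map_update_basis (EuclideanSpace.basisFun (Fin 3) ℝ).toBasis.det b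
    (fderiv ℝ (chartField (e k) c) y).toLinearMap
  rw [hb] at htrace
  rw [hjacobi, sub_mul, Finset.sum_mul]
  simp only [hbracket, ContinuousMultilinearMap.map_update_sub, Finset.sum_sub_distrib,
    he.detForm_update_chartField hy]
  exact congrArg (· - _) htrace

theorem fderiv_chartDensity_chartField (he : IsSmoothOrthonormalFrame g e)
    (hy : y ∈ (extChartAt (𝓡 3) c).target) (k : Fin 3) :
    fderiv ℝ (chartDensity g c) y (chartField (e k) c y)
      = chartDensity g c y * (∑ i, structureCoeff g e ((extChartAt (𝓡 3) c).symm y) i k i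
        - LinearMap.trace ℝ Model (fderiv ℝ (chartField (e k) c) y)) := by
  have hdet := he.chartDet_ne_zero hy
  have hderiv := (hasDerivAt_abs_inv hdet).comp_hasFDerivAt y
    ((he.contDiffAt_chartDet hy).differentiableAt (by simp)).hasFDerivAt
  rw [(hderiv.congr_of_eventuallyEq (he.chartDensity_eventuallyEq hy)).fderiv,
    he.chartDensity_eq hy, _root_.smul_apply, smul_eq_mul, he.fderiv_chartDet_chartField hy]
  field_simp
  ring

theorem trace_fderiv_smul_chartField (he : IsSmoothOrthonormalFrame g e)
    (hy : y ∈ (extChartAt (𝓡 3) c).target) (k : Fin 3)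
    (hf : MDifferentiableAt (𝓡 3) 𝓘(ℝ, ℝ) f ((extChartAt (𝓡 3) c).symm y)) :
    LinearMap.trace ℝ Model (fderiv ℝ (fun z =>
        (chartDensity g c z * f ((extChartAt (𝓡 3) c).symm z)) • chartField (e k) c z) y)
      = chartDensity g c y * frameDivergence g e k f ((extChartAt (𝓡 3) c).symm y) := by
  have hw := (he.contDiffAt_chartDensity hy).differentiableAt (by simp)
  have hfy : DifferentiableAt ℝ (fun z => f ((extChartAt (𝓡 3) c).symm z)) y :=
    (hf.comp y ((contMDiffAt_extChartAt_symm hy).mdifferentiableAt (by simp))).differentiableAt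
  rw [trace_fderiv_smul (hw.fun_mul hfy)
    ((contDiffAt_chartField (he.contMDiff k) hy).differentiableAt (by simp)),
    fderiv_fun_mul hw hfy, _root_.add_apply, _root_.smul_apply, _root_.smul_apply, smul_eq_mul,
    smul_eq_mul, he.fderiv_chartDensity_chartField hy, fderiv_chartField (e k) hy hf,
    frameDivergence]
  ring

theorem integral_frameDivergence_of_tsupport_subset [MeasurableSpace M] [BorelSpace M]
    (he : IsSmoothOrthonormalFrame g e) (k : Fin 3) (hf : ContMDiff (𝓡 3) 𝓘(ℝ, ℝ) ∞ f)
    (hfc : HasCompactSupport f) (hs : tsupport f ⊆ (extChartAt (𝓡 3) c).source) :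
    ∫ x, frameDivergence g e k f x ∂(volumeMeasure g) = 0 := by
  have hK : IsCompact (extChartAt (𝓡 3) c '' tsupport f) :=
    hfc.isCompact.image_of_continuousOn ((continuousOn_extChartAt c).mono hs)
  rw [← setIntegral_eq_integral_of_forall_compl_eq_zero (s := (extChartAt (𝓡 3) c).source)
    (fun x hx => frameDivergence_eq_zero g e k fun h => hx (hs h)),
    he.volumeMeasure_restrict_source,
    he.integral_chartVolume c (he.continuous_frameDivergence k hf).measurable,
    ← setIntegral_congr_fun (isOpen_extChartAt_target c).measurableSet fun y hy =>
      he.trace_fderiv_smul_chartField hy k (hf.mdifferentiableAt (by simp))]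
  refine setIntegral_trace_fderiv_eq_zero volume (isOpen_extChartAt_target c) hK ?_ ?_ ?_
  · rintro _ ⟨x, hx, rfl⟩
    exact (extChartAt (𝓡 3) c).map_source (hs hx)
  · intro y hy
    have hfy : ContDiffAt ℝ ∞ (fun z => f ((extChartAt (𝓡 3) c).symm z)) y :=
      (ContMDiffAt.comp y (hf _) (contMDiffAt_extChartAt_symm hy)).contDiffAt
    exact (((he.contDiffAt_chartDensity hy).mul hfy).smul
      (contDiffAt_chartField (he.contMDiff k) hy)).of_le (by simp)
  · intro y hy hyK
    have hfy : f ((extChartAt (𝓡 3) c).symm y) = 0 := by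
      by_contra h
      exact hyK ⟨_, subset_tsupport f h, (extChartAt (𝓡 3) c).right_inv hy⟩
    rw [hfy, mul_zero, zero_smul]

end IsSmoothOrthonormalFrame

theorem exists_sum_eq_of_hasCompactSupport [T2Space M] [SigmaCompactSpace M]
    (hf : ContMDiff (𝓡 3) 𝓘(ℝ, ℝ) ∞ f) (hfc : HasCompactSupport f) :
    ∃ (t : Finset M) (F : t → M → ℝ), f = ∑ c, F c ∧ ∀ c, ContMDiff (𝓡 3) 𝓘(ℝ, ℝ) ∞ (F c) ∧
      HasCompactSupport (F c) ∧ tsupport (F c) ⊆ (extChartAt (𝓡 3) (c : M)).source := by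
  obtain ⟨t, -, ht⟩ := hfc.isCompact.elim_nhds_subcover
    (fun x : M => (extChartAt (𝓡 3) x).source) fun x _ => extChartAt_source_mem_nhds x
  obtain ⟨χ, hχ⟩ := SmoothPartitionOfUnity.exists_isSubordinate (𝓡 3) (isClosed_tsupport f)
    (fun c : t => (extChartAt (𝓡 3) (c : M)).source) (fun c => isOpen_extChartAt_source (c : M))
    (by rwa [iUnion_subtype fun x => x ∈ t])
  refine ⟨t, fun c => χ c * f, funext fun x => ?_, fun c => ⟨(χ c).contMDiff.mul hf,
    hfc.mul_left, (closure_mono (Function.support_mul_subset_left _ _)).trans (hχ c)⟩⟩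
  simp only [Finset.sum_apply, Pi.mul_apply, ← Finset.sum_mul]
  by_cases hx : x ∈ tsupport f
  · rw [← finsum_eq_sum_of_fintype, χ.sum_eq_one hx, one_mul]
  · rw [image_eq_zero_of_notMem_tsupport hx, mul_zero]

theorem IsSmoothOrthonormalFrame.integral_frameDivergence [T2Space M] [SigmaCompactSpace M]
    [MeasurableSpace M] [BorelSpace M] (he : IsSmoothOrthonormalFrame g e) (k : Fin 3)
    (hf : ContMDiff (𝓡 3) 𝓘(ℝ, ℝ) ∞ f) (hfc : HasCompactSupport f) :
    ∫ x, frameDivergence g e k f x ∂(volumeMeasure g) = 0 := by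
  have := he.isLocallyFiniteMeasure_volumeMeasure
  obtain ⟨t, F, rfl, hF⟩ := exists_sum_eq_of_hasCompactSupport hf hfc
  simp only [frameDivergence_sum _ fun c _ => (hF c).1.mdifferentiableAt (by simp)]
  rw [integral_finsetSum]
  · exact Finset.sum_eq_zero fun c _ =>
      he.integral_frameDivergence_of_tsupport_subset k (hF c).1 (hF c).2.1 (hF c).2.2
  · exact fun c _ => (he.continuous_frameDivergence k (hF c).1).integrable_of_hasCompactSupport
      (HasCompactSupport.intro (hF c).2.1 fun _ => frameDivergence_eq_zero g e k)

end Divergence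

/-! ### Symmetry of the Dirac operator -/

section Inner

variable {V H F : Type*} [NormedAddCommGroup V] [NormedSpace ℝ V] [TopologicalSpace H]
  {I : ModelWithCorners ℝ V H} {M : Type*} [TopologicalSpace M] [ChartedSpace H M]
  [NormedAddCommGroup F] [InnerProductSpace ℝ F] {u v : M → F} {x : M}

theorem mvfderiv_inner (hu : MDifferentiableAt I 𝓘(ℝ, F) u x)
    (hv : MDifferentiableAt I 𝓘(ℝ, F) v x) (w : TangentSpace I x) :
    mvfderiv I (fun y => inner ℝ (u y) (v y)) x w
      = inner ℝ (u x) (mvfderiv I v x w) + inner ℝ (mvfderiv I u x w) (v x) := by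
  have hpair := hu.prodMk_space hv
  have hfst := mvfderiv_comp_of_hasFDerivAt hasFDerivAt_fst hpair w
  have hsnd := mvfderiv_comp_of_hasFDerivAt hasFDerivAt_snd hpair w
  have hinner : HasFDerivAt (fun p : F × F => inner ℝ p.1 p.2) _ (u x, v x) :=
    hasFDerivAt_fst.inner ℝ hasFDerivAt_snd
  refine (mvfderiv_comp_of_hasFDerivAt (f := fun y => (u y, v y)) hinner hpair w).trans ?_
  rw [hfst, hsnd]
  rfl

end Inner

section Symmetry

variable {M : Type*} [TopologicalSpace M] [ChartedSpace Model M] {U : Set ℝ}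

theorem contDiff_clifford (k : Fin 3) {n : WithTop ℕ∞} : ContDiff ℝ n (clifford k) :=
  ((clifford k).restrictScalars ℝ).contDiff

theorem hasFDerivAt_clifford (k : Fin 3) (w : Spinor) :
    HasFDerivAt (clifford k) ((clifford k).restrictScalars ℝ) w :=
  ((clifford k).restrictScalars ℝ).hasFDerivAt

theorem SmoothFamily.clifford {φ : ℝ → M → Spinor} (hφ : SmoothFamily (𝓡 3) U φ) (k : Fin 3) :
    SmoothFamily (𝓡 3) U (fun s x => clifford k (φ s x)) :=
  hφ.comp fun _ _ _ => (contDiff_clifford k).contDiffAt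

namespace IsSmoothOrthonormalFrame

variable [IsManifold (𝓡 3) ∞ M] {g : FormField M} {e : Fin 3 → VField M} {u v : M → Spinor} {x : M}

theorem smoothFamily_dirac (he : IsSmoothOrthonormalFrame g e) {φ : ℝ → M → Spinor}
    (hφ : SmoothFamily (𝓡 3) U φ) : SmoothFamily (𝓡 3) U (fun s => dirac g e (φ s)) := by
  have hκ (k i j : Fin 3) : SmoothFamily (𝓡 3) U
      (fun _ x => (1 / 4 : ℝ) * koszulCoeff (structureCoeff g e x) k i j) :=
    .const (contMDiff_const.mul (contMDiff_const.mul
      (((he.contMDiff_structureCoeff k i j).sub (he.contMDiff_structureCoeff i j k)).add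
        (he.contMDiff_structureCoeff j k i))))
  have hdirac (s : ℝ) : dirac g e (φ s) = fun x => ∑ k, (clifford k (mvfderiv (𝓡 3) (φ s) x (e k x))
      + ∑ i, ∑ j, ((1 / 4 : ℝ) * koszulCoeff (structureCoeff g e x) k i j) •
        clifford k (clifford i (clifford j (φ s x)))) := by
    funext x
    simp only [he.dirac_eq, Finset.smul_sum, Finset.sum_add_distrib, mul_smul]
  simp only [hdirac]
  exact .sum fun k _ => ((hφ.mvfderiv (he.contMDiff k)).clifford k).add (.sum fun i _ =>
    .sum fun j _ => (hκ k i j).smul (((hφ.clifford j).clifford i).clifford k))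

theorem contMDiff_dirac (he : IsSmoothOrthonormalFrame g e)
    (hu : ContMDiff (𝓡 3) 𝓘(ℝ, Spinor) ∞ u) : ContMDiff (𝓡 3) 𝓘(ℝ, Spinor) ∞ (dirac g e u) :=
  (he.smoothFamily_dirac (.const hu)).contMDiff (mem_univ (0 : ℝ))

theorem inner_dirac_sub (he : IsSmoothOrthonormalFrame g e)
    (hu : MDifferentiableAt (𝓡 3) 𝓘(ℝ, Spinor) u x)
    (hv : MDifferentiableAt (𝓡 3) 𝓘(ℝ, Spinor) v x) :
    inner ℝ (dirac g e u x) (v x) - inner ℝ (u x) (dirac g e v x)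
      = ∑ k, frameDivergence g e k (fun y => inner ℝ (clifford k (u y)) (v y)) x := by
  have hc := structureCoeff_swap g e x
  have connection := inner_connection_sub (koszulCoeff_swap hc) (u x) (v x)
  have leibniz (k : Fin 3) : mvfderiv (𝓡 3) (fun y => inner ℝ (clifford k (u y)) (v y)) x (e k x)
      = inner ℝ (clifford k (mvfderiv (𝓡 3) u x (e k x))) (v x)
        - inner ℝ (u x) (clifford k (mvfderiv (𝓡 3) v x (e k x))) := by
    have hku : MDifferentiableAt (𝓡 3) 𝓘(ℝ, Spinor) (fun y => clifford k (u y)) x :=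
      (hasFDerivAt_clifford k _).differentiableAt.mdifferentiableAt.comp x hu
    rw [mvfderiv_inner hku hv, mvfderiv_comp_of_hasFDerivAt (hasFDerivAt_clifford k _) hu,
      real_inner_clifford_left, neg_add_eq_sub]
    rfl
  simp only [frameDivergence, leibniz, Finset.sum_add_distrib, Finset.sum_sub_distrib]
  simp only [sum_koszulCoeff hc, mul_comm (∑ i, structureCoeff g e x i _ i)] at connection
  rw [he.dirac_eq, he.dirac_eq, inner_add_left, inner_add_right, ← connection, sum_inner, inner_sum]
  ring

theorem integrable_of_continuous [CompactSpace M] [T2Space M] [MeasurableSpace M] [BorelSpace M]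
    {F : Type*} [NormedAddCommGroup F] (he : IsSmoothOrthonormalFrame g e) {f : M → F}
    (hf : Continuous f) : Integrable f (volumeMeasure g) :=
  have := he.isLocallyFiniteMeasure_volumeMeasure
  hf.integrable_of_hasCompactSupport (.of_compactSpace f)

theorem integral_inner_dirac [CompactSpace M] [T2Space M] [MeasurableSpace M] [BorelSpace M]
    (he : IsSmoothOrthonormalFrame g e) (hu : ContMDiff (𝓡 3) 𝓘(ℝ, Spinor) ∞ u)
    (hv : ContMDiff (𝓡 3) 𝓘(ℝ, Spinor) ∞ v) :
    ∫ x, inner ℝ (dirac g e u x) (v x) ∂(volumeMeasure g)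
      = ∫ x, inner ℝ (u x) (dirac g e v x) ∂(volumeMeasure g) := by
  have smooth (k : Fin 3) :
      ContMDiff (𝓡 3) 𝓘(ℝ, ℝ) ∞ (fun y => inner ℝ (clifford k (u y)) (v y)) :=
    (contDiff_fst.inner ℝ contDiff_snd).contMDiff.comp
      (((contDiff_clifford k).contMDiff.comp hu).prodMk_space hv)
  rw [← sub_eq_zero,
    ← integral_sub
      (he.integrable_of_continuous ((he.contMDiff_dirac hu).continuous.inner hv.continuous))
      (he.integrable_of_continuous (hu.continuous.inner (he.contMDiff_dirac hv).continuous))]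
  simp only [he.inner_dirac_sub (hu.mdifferentiableAt (by simp)) (hv.mdifferentiableAt (by simp))]
  rw [integral_finsetSum _ fun k _ =>
    he.integrable_of_continuous (he.continuous_frameDivergence k (smooth k))]
  exact Finset.sum_eq_zero fun k _ =>
    he.integral_frameDivergence k (smooth k) (.of_compactSpace _)

end IsSmoothOrthonormalFrame

end Symmetry

/-! ### Conformal evolution of the metric, the Dirac operator and the volume -/

theorem deriv_fun_inv_eq_logDeriv {𝕜 : Type*} [NontriviallyNormedField 𝕜] {f : 𝕜 → 𝕜} {t : 𝕜}
    (hf : DifferentiableAt 𝕜 f t) (hf₀ : f t ≠ 0) :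
    deriv (fun s => (f s)⁻¹) t = -logDeriv f t * (f t)⁻¹ := by
  rw [deriv_fun_inv'' hf hf₀, logDeriv_apply]
  field_simp

section ConformalVelocity

variable {M : Type*} [TopologicalSpace M] [ChartedSpace Model M] {g : FormField M}
  {e : Fin 3 → VField M} {r : ℝ → M → ℝ} {t : ℝ} {x : M}

/-- The velocity `∂ₜ (r² g)` of a conformal family of metrics; `metricVelocity` is the case
`r = |ψ|`. -/
def conformalVelocity (r : ℝ → M → ℝ) (g : FormField M) (t : ℝ) (x : M)
    (v w : TangentSpace (𝓡 3) x) : ℝ :=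
  deriv (fun s => conformalMetric (r s) g x v w) t

theorem hasDerivAt_conformalMetric (hr : DifferentiableAt ℝ (fun s => r s x) t)
    (v w : TangentSpace (𝓡 3) x) : HasDerivAt (fun s => conformalMetric (r s) g x v w)
      (conformalVelocity r g t x v w) t :=
  ((hr.fun_pow 2).mul_const (g x v w)).hasDerivAt

theorem conformalVelocity_eq (hr : DifferentiableAt ℝ (fun s => r s x) t)
    (v w : TangentSpace (𝓡 3) x) : conformalVelocity r g t x v w
      = 2 * logDeriv (fun s => r s x) t * conformalMetric (r t) g x v w := by
  refine ((hr.hasDerivAt.fun_pow 2).mul_const (g x v w)).deriv.trans ?_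
  simp only [logDeriv_apply, conformalMetric, _root_.smul_apply, smul_eq_mul]
  field_simp
  norm_num
  ring

variable [IsManifold (𝓡 3) ∞ M]

theorem IsSmoothOrthonormalFrame.frameTrace_eq (he : IsSmoothOrthonormalFrame g e)
    {h : ∀ x : M, TangentSpace (𝓡 3) x → TangentSpace (𝓡 3) x → ℝ} {c : ℝ}
    (hh : ∀ v w, h x v w = c * g x v w) : frameTrace e h x = 3 * c := by
  simp only [frameTrace, hh, he.apply_apply, if_true, mul_one, Fin.sum_univ_three]
  ring

end ConformalVelocity

section Evolution

variable {M : Type*} [TopologicalSpace M] [ChartedSpace Model M] [IsManifold (𝓡 3) ∞ M]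
  {g : FormField M} {e : Fin 3 → VField M} {r : ℝ → M → ℝ} {φ : ℝ → M → Spinor} {U : Set ℝ}
  {t : ℝ}

namespace IsSmoothOrthonormalFrame

theorem frameTrace_conformalVelocity (he : IsSmoothOrthonormalFrame g e)
    (hr : SmoothFamily (𝓡 3) U r) (hr₀ : ∀ t ∈ U, ∀ x, r t x ≠ 0) (ht : t ∈ U) :
    frameTrace (conformalFrame (r t) e) (conformalVelocity r g t)
      = fun x => 6 * logDeriv (fun s => r s x) t := by
  funext x
  rw [(he.conformal (hr.contMDiff ht) (hr₀ t ht)).frameTrace_eq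
    (conformalVelocity_eq (hr.hasDerivAt ht x).differentiableAt)]
  ring

theorem conformalVelocity_eq_frameTrace_mul (he : IsSmoothOrthonormalFrame g e)
    (hr : SmoothFamily (𝓡 3) U r) (hr₀ : ∀ t ∈ U, ∀ x, r t x ≠ 0) (ht : t ∈ U) (x : M)
    (v w : TangentSpace (𝓡 3) x) : conformalVelocity r g t x v w
      = frameTrace (conformalFrame (r t) e) (conformalVelocity r g t) x / 3
        * conformalMetric (r t) g x v w := by
  rw [conformalVelocity_eq (hr.hasDerivAt ht x).differentiableAt,
    he.frameTrace_conformalVelocity hr hr₀ ht]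
  ring

theorem contMDiff_frameTrace_conformalVelocity (he : IsSmoothOrthonormalFrame g e)
    (hr : SmoothFamily (𝓡 3) U r) (hr₀ : ∀ t ∈ U, ∀ x, r t x ≠ 0) (ht : t ∈ U) :
    ContMDiff (𝓡 3) 𝓘(ℝ, ℝ) ∞
      (frameTrace (conformalFrame (r t) e) (conformalVelocity r g t)) := by
  rw [he.frameTrace_conformalVelocity hr hr₀ ht]
  exact contMDiff_const.mul ((hr.logDeriv hr₀).contMDiff ht)

theorem diracVariation_conformalVelocity (he : IsSmoothOrthonormalFrame g e)
    (hr : SmoothFamily (𝓡 3) U r) (hr₀ : ∀ t ∈ U, ∀ x, r t x ≠ 0) (ht : t ∈ U)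
    (φ : M → Spinor) (x : M) :
    diracVariation (conformalMetric (r t) g) (conformalFrame (r t) e) (conformalVelocity r g t) φ x
      = deriv (fun s => (r s x)⁻¹) t • dirac g e φ x
        - ∑ k, mvfderiv (𝓡 3) (fun y => deriv (fun s => (r s y)⁻¹) t) x (e k x) •
          clifford k (φ x) := by
  have htrace := (hr.logDeriv hr₀).mdifferentiableAt ht x
  have hinv := (hr.inv₀ hr₀).mdifferentiableAt ht x
  have hderiv (y : M) :=
    deriv_fun_inv_eq_logDeriv (hr.hasDerivAt ht y).differentiableAt (hr₀ t ht y)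
  have leibniz (v : TangentSpace (𝓡 3) x) :
      mvfderiv (𝓡 3) (fun y => -logDeriv (fun s => r s y) t * (r t y)⁻¹) x v
        = -logDeriv (fun s => r s x) t * mvfderiv (𝓡 3) (fun y => (r t y)⁻¹) x v
          - (r t x)⁻¹ * mvfderiv (𝓡 3) (fun y => logDeriv (fun s => r s y) t) x v := by
    rw [mvfderiv_fun_mul (f := fun y => -logDeriv (fun s => r s y) t) htrace.neg hinv,
      mvfderiv_fun_neg]
    simp only [_root_.add_apply, _root_.smul_apply, _root_.neg_apply, smul_eq_mul]
    ring
  have six (v : TangentSpace (𝓡 3) x) :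
      mvfderiv (𝓡 3) (fun y => 6 * logDeriv (fun s => r s y) t) x v
        = 6 * mvfderiv (𝓡 3) (fun y => logDeriv (fun s => r s y) t) x v := by
    rw [mvfderiv_fun_mul mdifferentiableAt_const htrace, mvfderiv_const]
    simp only [_root_.add_apply, _root_.smul_apply, _root_.zero_apply, smul_eq_mul]
    ring
  rw [diracVariation, he.frameTrace_conformalVelocity hr hr₀ ht,
    dirac_conformal he (hr.contMDiff ht) (hr₀ t ht)]
  simp only [hderiv, leibniz, six, conformalFrame, map_smul, smul_eq_mul]
  simp only [sub_smul, Finset.sum_sub_distrib, mul_smul, ← Finset.smul_sum, neg_smul,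
    Finset.sum_neg_distrib]
  module

theorem hasDerivAt_dirac (he : IsSmoothOrthonormalFrame g e) (hφ : SmoothFamily (𝓡 3) U φ)
    (hU : U ∈ nhds t) (x : M) : HasDerivAt (fun s => dirac g e (φ s) x)
      (dirac g e (fun y => deriv (fun s => φ s y) t) x) t := by
  have hcliff (k : Fin 3) {f : ℝ → Spinor} {f' : Spinor} (hf : HasDerivAt f f' t) :
      HasDerivAt (fun s => clifford k (f s)) (clifford k f') t :=
    (hasFDerivAt_clifford k _).comp_hasDerivAt t hf
  have hφt := hφ.hasDerivAt (mem_of_mem_nhds hU) x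
  simp only [he.dirac_eq]
  exact (HasDerivAt.fun_sum fun k _ => hcliff k (hφ.hasDerivAt_mvfderiv hU x (e k x))).add
    (.fun_const_smul _ (.fun_sum fun k _ => .fun_sum fun i _ => .fun_sum fun j _ =>
      .fun_const_smul _ (hcliff k (hcliff i (hcliff j hφt)))))

theorem smoothFamily_dirac_conformal (he : IsSmoothOrthonormalFrame g e)
    (hr : SmoothFamily (𝓡 3) U r) (hr₀ : ∀ t ∈ U, ∀ x, r t x ≠ 0) (hφ : SmoothFamily (𝓡 3) U φ)
    (hU : IsOpen U) : SmoothFamily (𝓡 3) U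
      (fun s => dirac (conformalMetric (r s) g) (conformalFrame (r s) e) (φ s)) := by
  have hinv := hr.inv₀ hr₀
  refine ((hinv.smul (he.smoothFamily_dirac hφ)).sub (.sum (s := Finset.univ) fun k _ =>
    (hinv.mvfderiv (he.contMDiff k)).smul (hφ.clifford k))).congr hU fun s hs x => ?_
  exact dirac_conformal he (hr.contMDiff hs) (hr₀ s hs) (φ s) x

theorem hasDerivAt_dirac_conformal (he : IsSmoothOrthonormalFrame g e)
    (hr : SmoothFamily (𝓡 3) U r) (hr₀ : ∀ t ∈ U, ∀ x, r t x ≠ 0) (hφ : SmoothFamily (𝓡 3) U φ)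
    (hU : U ∈ nhds t) (x : M) :
    HasDerivAt (fun s => dirac (conformalMetric (r s) g) (conformalFrame (r s) e) (φ s) x)
      (diracVariation (conformalMetric (r t) g) (conformalFrame (r t) e) (conformalVelocity r g t)
          (φ t) x
        + dirac (conformalMetric (r t) g) (conformalFrame (r t) e)
          (fun y => deriv (fun s => φ s y) t) x) t := by
  have ht := mem_of_mem_nhds hU
  have hinv := hr.inv₀ hr₀
  have hcliff (k : Fin 3) : HasDerivAt (fun s => clifford k (φ s x))
      (clifford k (deriv (fun s => φ s x) t)) t :=
    (hasFDerivAt_clifford k _).comp_hasDerivAt t (hφ.hasDerivAt ht x)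
  have product := ((hinv.hasDerivAt ht x).fun_smul (he.hasDerivAt_dirac hφ hU x)).fun_sub
    (.fun_sum (u := Finset.univ) fun k _ =>
      (hinv.hasDerivAt_mvfderiv hU x (e k x)).fun_smul (hcliff k))
  refine (product.congr_deriv ?_).congr_of_eventuallyEq ?_
  · rw [he.diracVariation_conformalVelocity hr hr₀ ht,
      dirac_conformal he (hr.contMDiff ht) (hr₀ t ht), Finset.sum_add_distrib]
    abel
  · filter_upwards [hU] with s hs
    exact dirac_conformal he (hr.contMDiff hs) (hr₀ s hs) (φ s) x

theorem hasDerivAt_dirac_conformal_const (he : IsSmoothOrthonormalFrame g e)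
    (hr : SmoothFamily (𝓡 3) U r) (hr₀ : ∀ t ∈ U, ∀ x, r t x ≠ 0) {φ : M → Spinor}
    (hφ : ContMDiff (𝓡 3) 𝓘(ℝ, Spinor) ∞ φ) (hU : U ∈ nhds t) (x : M) :
    HasDerivAt (fun s => dirac (conformalMetric (r s) g) (conformalFrame (r s) e) φ x)
      (diracVariation (conformalMetric (r t) g) (conformalFrame (r t) e) (conformalVelocity r g t)
        φ x) t := by
  simpa only [deriv_const, dirac_zero, add_zero] using
    he.hasDerivAt_dirac_conformal hr hr₀ (.const hφ) hU x

end IsSmoothOrthonormalFrame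

end Evolution

section Variation

variable {M : Type*} [TopologicalSpace M] [ChartedSpace Model M] [IsManifold (𝓡 3) ∞ M]
  {g : FormField M} {e : Fin 3 → VField M} {U : Set ℝ} {t : ℝ}

namespace IsSmoothOrthonormalFrame

section Reaction

variable {h : ∀ x : M, TangentSpace (𝓡 3) x → TangentSpace (𝓡 3) x → ℝ} {φ : M → Spinor}

theorem contMDiff_diracVariation (he : IsSmoothOrthonormalFrame g e)
    (hh : ContMDiff (𝓡 3) 𝓘(ℝ, ℝ) ∞ (frameTrace e h)) (hφ : ContMDiff (𝓡 3) 𝓘(ℝ, Spinor) ∞ φ) :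
    ContMDiff (𝓡 3) 𝓘(ℝ, Spinor) ∞ (diracVariation g e h φ) := by
  have : IsManifold (𝓡 3) 1 M := .of_le (n := ∞) (by simp)
  have gradient (k : Fin 3) : ContMDiff (𝓡 3) 𝓘(ℝ, ℝ) ∞
      (fun x => mvfderiv (𝓡 3) (frameTrace e h) x (e k x)) :=
    ((SmoothFamily.const hh).mvfderiv (he.contMDiff k)).contMDiff (mem_univ (0 : ℝ))
  have clifford_gradient (k : Fin 3) : ContMDiff (𝓡 3) 𝓘(ℝ, Spinor) ∞
      (fun x => mvfderiv (𝓡 3) (frameTrace e h) x (e k x) • clifford k (φ x)) :=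
    (gradient k).smul ((contDiff_clifford k).contMDiff.comp hφ)
  have difference := (contMDiff_finsetSum (t := Finset.univ) fun k _ => clifford_gradient k).sub
    (hh.smul (he.contMDiff_dirac hφ))
  exact (contDiff_const_smul (1 / 6 : ℝ)).contMDiff.comp difference

variable [CompactSpace M] [T2Space M] [MeasurableSpace M] [BorelSpace M]

theorem integrable_norm_sq_dirac (he : IsSmoothOrthonormalFrame g e)
    (hφ : ContMDiff (𝓡 3) 𝓘(ℝ, Spinor) ∞ φ) :
    Integrable (fun x => ‖dirac g e φ x‖ ^ 2) (volumeMeasure g) :=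
  he.integrable_of_continuous ((he.contMDiff_dirac hφ).continuous.norm.pow 2)

theorem integrable_metricReaction (he : IsSmoothOrthonormalFrame g e)
    (hh : ContMDiff (𝓡 3) 𝓘(ℝ, ℝ) ∞ (frameTrace e h)) (hφ : ContMDiff (𝓡 3) 𝓘(ℝ, Spinor) ∞ φ) :
    Integrable (metricReaction g e h φ) (volumeMeasure g) :=
  he.integrable_of_continuous (continuous_const.mul
    ((he.contMDiff_diracVariation hh hφ).continuous.inner (𝕜 := ℝ)
      (he.contMDiff_dirac hφ).continuous))

theorem integrable_volumeReaction (he : IsSmoothOrthonormalFrame g e)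
    (hh : ContMDiff (𝓡 3) 𝓘(ℝ, ℝ) ∞ (frameTrace e h)) (hφ : ContMDiff (𝓡 3) 𝓘(ℝ, Spinor) ∞ φ) :
    Integrable (volumeReaction g e h φ) (volumeMeasure g) :=
  he.integrable_of_continuous ((continuous_const.mul hh.continuous).mul
    ((he.contMDiff_dirac hφ).continuous.norm.pow 2))

theorem integral_inner_dirac_diracVariation_add (he : IsSmoothOrthonormalFrame g e)
    (hh : ContMDiff (𝓡 3) 𝓘(ℝ, ℝ) ∞ (frameTrace e h)) (hφ : ContMDiff (𝓡 3) 𝓘(ℝ, Spinor) ∞ φ)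
    {χ : M → Spinor} (hχ : ContMDiff (𝓡 3) 𝓘(ℝ, Spinor) ∞ χ) :
    ∫ x, (2 * inner ℝ (dirac g e φ x) (diracVariation g e h φ x + dirac g e χ x)
        + 1 / 2 * frameTrace e h x * ‖dirac g e φ x‖ ^ 2) ∂(volumeMeasure g)
      = 2 * (∫ x, inner ℝ (dirac g e (dirac g e φ) x) (χ x) ∂(volumeMeasure g))
        + reaction g e h φ := by
  have hDφ := he.contMDiff_dirac hφ
  have hinner : Integrable (fun x => inner ℝ (dirac g e φ x) (dirac g e χ x)) (volumeMeasure g) :=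
    he.integrable_of_continuous (hDφ.continuous.inner (he.contMDiff_dirac hχ).continuous)
  have hm := he.integrable_metricReaction hh hφ
  have hv := he.integrable_volumeReaction hh hφ
  rw [he.integral_inner_dirac hDφ hχ, reaction, ← integral_add hm hv, ← integral_const_mul,
    ← integral_add (hinner.const_mul 2) (by exact hm.add hv)]
  refine integral_congr_ae (.of_forall fun x => ?_)
  simp only [metricReaction, volumeReaction, re_inner_eq_real_inner, inner_add_right,
    real_inner_comm (diracVariation g e h φ x)]
  ring

end Reaction

theorem setIntegral_volumeMeasure_conformal [SigmaCompactSpace M]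
    [MeasurableSpace M] [BorelSpace M] {F : Type*}
    [NormedAddCommGroup F] [NormedSpace ℝ F] {r : M → ℝ}
    (he : IsSmoothOrthonormalFrame g e) (hr : ContMDiff (𝓡 3) 𝓘(ℝ, ℝ) ∞ r) (hr₀ : ∀ x, 0 < r x)
    {A : Set M} (hA : MeasurableSet A) (f : M → F) :
    ∫ x in A, f x ∂(volumeMeasure (conformalMetric r g))
      = ∫ x in A, r x ^ 3 • f x ∂(volumeMeasure g) := by
  rw [he.volumeMeasure_conformal hr hr₀, setIntegral_withDensity_eq_setIntegral_toReal_smul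
    (hr.continuous.measurable.pow_const 3).ennreal_ofReal (.of_forall fun _ =>
      ENNReal.ofReal_lt_top) f hA]
  simp only [ENNReal.toReal_ofReal (pow_nonneg (hr₀ _).le 3)]

variable [CompactSpace M] [T2Space M] [MeasurableSpace M] [BorelSpace M] {r : ℝ → M → ℝ}

theorem hasDerivAt_setIntegral_volumeMeasure_conformal (he : IsSmoothOrthonormalFrame g e)
    (hr : SmoothFamily (𝓡 3) U r) (hr₀ : ∀ t ∈ U, ∀ x, 0 < r t x) (hU : U ∈ nhds t)
    {a : ℝ → M → ℝ} (ha : SmoothFamily (𝓡 3) U a) {A : Set M} (hA : MeasurableSet A) :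
    HasDerivAt (fun s => ∫ x in A, a s x ∂(volumeMeasure (conformalMetric (r s) g)))
      (∫ x in A, (deriv (fun s => a s x) t
          + 1 / 2 * frameTrace (conformalFrame (r t) e) (conformalVelocity r g t) x * a t x)
        ∂(volumeMeasure (conformalMetric (r t) g))) t := by
  have : IsManifold (𝓡 3) 1 M := .of_le (n := ∞) (by simp)
  have := he.isLocallyFiniteMeasure_volumeMeasure
  have ht := mem_of_mem_nhds hU
  have hra : SmoothFamily (𝓡 3) U (fun s x => r s x ^ 3 • a s x) :=
    (hr.comp fun _ _ _ => contDiff_id.contDiffAt.pow 3).smul ha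
  have product (x : M) : deriv (fun s => r s x ^ 3 • a s x) t
      = r t x ^ 3 • (deriv (fun s => a s x) t
        + 1 / 2 * frameTrace (conformalFrame (r t) e) (conformalVelocity r g t) x * a t x) := by
    have hx := (hr₀ t ht x).ne'
    rw [(((hr.hasDerivAt ht x).fun_pow 3).fun_smul (ha.hasDerivAt ht x)).deriv,
      he.frameTrace_conformalVelocity hr (fun t ht x => (hr₀ t ht x).ne') ht]
    simp only [logDeriv_apply, smul_eq_mul]
    field_simp
    ring
  refine ((hra.hasDerivAt_integral hU ((volumeMeasure g).restrict A)).congr_deriv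
    ?_).congr_of_eventuallyEq ?_
  · simp only [product, he.setIntegral_volumeMeasure_conformal (hr.contMDiff ht) (hr₀ t ht) hA]
  · filter_upwards [hU] with s hs
    exact he.setIntegral_volumeMeasure_conformal (hr.contMDiff hs) (hr₀ s hs) hA (a s)

theorem hasDerivAt_measureReal_conformal (he : IsSmoothOrthonormalFrame g e)
    (hr : SmoothFamily (𝓡 3) U r) (hr₀ : ∀ t ∈ U, ∀ x, 0 < r t x) (hU : U ∈ nhds t)
    {A : Set M} (hA : MeasurableSet A) :
    HasDerivAt (fun s => (volumeMeasure (conformalMetric (r s) g)).real A)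
      (∫ x in A, 1 / 2 * frameTrace (conformalFrame (r t) e) (conformalVelocity r g t) x
        ∂(volumeMeasure (conformalMetric (r t) g))) t := by
  have transport := he.hasDerivAt_setIntegral_volumeMeasure_conformal hr hr₀ hU
    (.const (contMDiff_const (c := (1 : ℝ)))) hA
  simpa only [setIntegral_const, smul_eq_mul, mul_one, deriv_const, zero_add] using transport

variable {φ : ℝ → M → Spinor}

theorem hasDerivAt_integral_norm_sq_dirac_conformal (he : IsSmoothOrthonormalFrame g e)
    (hr : SmoothFamily (𝓡 3) U r) (hr₀ : ∀ t ∈ U, ∀ x, 0 < r t x) (hφ : SmoothFamily (𝓡 3) U φ)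
    (hU : IsOpen U) (ht : t ∈ U) :
    HasDerivAt (fun s => ∫ x, ‖dirac (conformalMetric (r s) g) (conformalFrame (r s) e) (φ s) x‖ ^ 2
        ∂(volumeMeasure (conformalMetric (r s) g)))
      (2 * (∫ x, inner ℝ (dirac (conformalMetric (r t) g) (conformalFrame (r t) e)
          (dirac (conformalMetric (r t) g) (conformalFrame (r t) e) (φ t)) x)
          (deriv (fun s => φ s x) t) ∂(volumeMeasure (conformalMetric (r t) g)))
        + reaction (conformalMetric (r t) g) (conformalFrame (r t) e) (conformalVelocity r g t)
          (φ t)) t := by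
  have : IsManifold (𝓡 3) 1 M := .of_le (n := ∞) (by simp)
  have hr₀' : ∀ t ∈ U, ∀ x, r t x ≠ 0 := fun t ht x => (hr₀ t ht x).ne'
  have het := he.conformal (hr.contMDiff ht) (hr₀' t ht)
  have hh := he.contMDiff_frameTrace_conformalVelocity hr hr₀' ht
  have transport := he.hasDerivAt_setIntegral_volumeMeasure_conformal hr hr₀ (hU.mem_nhds ht)
    ((he.smoothFamily_dirac_conformal hr hr₀' hφ hU).comp fun _ _ _ =>
      (contDiff_norm_sq ℝ).contDiffAt) MeasurableSet.univ
  have velocity (x : M) :=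
    (he.hasDerivAt_dirac_conformal hr hr₀' hφ (hU.mem_nhds ht) x).norm_sq.deriv
  simp only [Measure.restrict_univ, velocity] at transport
  exact transport.congr_deriv
    (het.integral_inner_dirac_diracVariation_add hh (hφ.contMDiff ht) (hφ.deriv.contMDiff ht))

theorem hasDerivAt_integral_norm_sq_dirac_conformal_of_flow (he : IsSmoothOrthonormalFrame g e)
    (hr : SmoothFamily (𝓡 3) U r) (hr₀ : ∀ t ∈ U, ∀ x, 0 < r t x) (hφ : SmoothFamily (𝓡 3) U φ)
    (hU : IsOpen U) (ht : t ∈ U) (hflow : ∀ x, HasDerivAt (fun s => φ s x)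
      (-dirac (conformalMetric (r t) g) (conformalFrame (r t) e)
        (dirac (conformalMetric (r t) g) (conformalFrame (r t) e) (φ t)) x) t) :
    HasDerivAt (fun s => ∫ x, ‖dirac (conformalMetric (r s) g) (conformalFrame (r s) e) (φ s) x‖ ^ 2
        ∂(volumeMeasure (conformalMetric (r s) g)))
      (-2 * (∫ x, ‖dirac (conformalMetric (r t) g) (conformalFrame (r t) e)
          (dirac (conformalMetric (r t) g) (conformalFrame (r t) e) (φ t)) x‖ ^ 2
          ∂(volumeMeasure (conformalMetric (r t) g)))
        + reaction (conformalMetric (r t) g) (conformalFrame (r t) e) (conformalVelocity r g t)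
          (φ t)) t := by
  have variation := he.hasDerivAt_integral_norm_sq_dirac_conformal hr hr₀ hφ hU ht
  simpa only [(hflow _).deriv, inner_neg_right, real_inner_self_eq_norm_sq, integral_neg, mul_neg,
    neg_mul] using variation

end IsSmoothOrthonormalFrame

end Variation

end SpinorFlow

end

theorem mainTheorem2 {M : Type*} [TopologicalSpace M] [ChartedSpace SpinorFlow.Model M]
    [IsManifold (𝓡 3) ∞ M] [CompactSpace M] [T2Space M] [MeasurableSpace M] [BorelSpace M]
    -- the background metric and a global orthonormal frame
    (g₀ : Bundle.ContMDiffRiemannianMetric (𝓡 3) ∞ SpinorFlow.Model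
      (fun x : M => TangentSpace (𝓡 3) x))
    (E : Fin 3 → SpinorFlow.VField M)
    (hE : ∀ k, ContMDiff (𝓡 3) ((𝓡 3).prod 𝓘(ℝ, SpinorFlow.Model)) ∞
      (fun x => (⟨x, E k x⟩ : TangentBundle (𝓡 3) M)))
    (hE_orth : ∀ x i j, g₀.inner x (E i x) (E j x) = if i = j then 1 else 0)
    -- a smooth nowhere vanishing solution of the flow on `M × (0, T)`
    (T : ℝ) (ψ : ℝ → M → SpinorFlow.Spinor)
    (hψ : ContMDiffOn (𝓘(ℝ, ℝ).prod (𝓡 3)) 𝓘(ℝ, SpinorFlow.Spinor) ∞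
      (fun p : ℝ × M => ψ p.1 p.2) (Ioo 0 T ×ˢ univ))
    (hψ_ne : ∀ t ∈ Ioo 0 T, ∀ x, ψ t x ≠ 0)
    (hflow : ∀ t ∈ Ioo 0 T, ∀ x, HasDerivAt (fun s => ψ s x)
      (-SpinorFlow.inducedDirac g₀.inner E (ψ t)
        (SpinorFlow.inducedDirac g₀.inner E (ψ t) (ψ t)) x) t)
    (t : ℝ) (ht : t ∈ Ioo 0 T) :
    let g : SpinorFlow.FormField M := SpinorFlow.inducedMetric g₀.inner (ψ t)
    let e : Fin 3 → SpinorFlow.VField M := SpinorFlow.inducedFrame E (ψ t)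
    let h := SpinorFlow.metricVelocity g₀.inner ψ t
    let D : (M → SpinorFlow.Spinor) → M → SpinorFlow.Spinor := SpinorFlow.dirac g e
    let dV : Measure M := SpinorFlow.volumeMeasure g
    -- all the integrals exist
    (Integrable (fun x => ‖D (ψ t) x‖ ^ 2) dV ∧
      Integrable (fun x => ‖D (D (ψ t)) x‖ ^ 2) dV ∧
      Integrable (SpinorFlow.metricReaction g e h (ψ t)) dV ∧
      Integrable (SpinorFlow.volumeReaction g e h (ψ t)) dV) ∧
    -- the energy evolution
    HasDerivAt (fun s => SpinorFlow.energy g₀.inner E (ψ s))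
      (-2 * (∫ x, ‖D (D (ψ t)) x‖ ^ 2 ∂dV) + SpinorFlow.reaction g e h (ψ t)) t ∧
    -- the metric varies by `h`, which is conformal
    (∀ x v w, HasDerivAt (fun s => SpinorFlow.inducedMetric g₀.inner (ψ s) x v w) (h x v w) t ∧
      h x v w = SpinorFlow.frameTrace e h x / 3 * g x v w) ∧
    -- the Dirac operator, applied to a fixed spinor field, varies as in the reaction term
    (∀ φ : M → SpinorFlow.Spinor, ContMDiff (𝓡 3) 𝓘(ℝ, SpinorFlow.Spinor) ∞ φ → ∀ x,
      HasDerivAt (fun s => SpinorFlow.inducedDirac g₀.inner E (ψ s) φ x)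
        (SpinorFlow.diracVariation g e h φ x) t) ∧
    -- the volume measure varies as in the reaction term
    (∀ A : Set M, MeasurableSet A →
      HasDerivAt (fun s => (SpinorFlow.inducedVolume g₀.inner (ψ s)).real A)
        (∫ x in A, (1 / 2) * SpinorFlow.frameTrace e h x ∂dV) t) := by
  intro g e h D dV
  have he : SpinorFlow.IsSmoothOrthonormalFrame g₀.inner E := ⟨hE, hE_orth⟩
  have hU : Ioo 0 T ∈ nhds t := isOpen_Ioo.mem_nhds ht
  have smooth : SpinorFlow.SmoothFamily (𝓡 3) (Ioo 0 T) ψ := fun s hs x =>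
    hψ.contMDiffAt ((isOpen_Ioo.prod isOpen_univ).mem_nhds ⟨hs, mem_univ x⟩)
  have smooth_norm := smooth.norm hψ_ne
  have norm_ne (s) (hs : s ∈ Ioo 0 T) (x : M) : ‖ψ s x‖ ≠ 0 := norm_ne_zero_iff.2 (hψ_ne s hs x)
  have norm_pos (s) (hs : s ∈ Ioo 0 T) (x : M) : 0 < ‖ψ s x‖ := norm_pos_iff.2 (hψ_ne s hs x)
  have frame : SpinorFlow.IsSmoothOrthonormalFrame g e :=
    he.conformal (smooth_norm.contMDiff ht) (norm_ne t ht)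
  have trace := he.contMDiff_frameTrace_conformalVelocity smooth_norm norm_ne ht
  have smooth_t := smooth.contMDiff ht
  exact ⟨⟨frame.integrable_norm_sq_dirac smooth_t,
      frame.integrable_norm_sq_dirac (frame.contMDiff_dirac smooth_t),
      frame.integrable_metricReaction trace smooth_t,
      frame.integrable_volumeReaction trace smooth_t⟩,
    he.hasDerivAt_integral_norm_sq_dirac_conformal_of_flow smooth_norm norm_pos smooth isOpen_Ioo
      ht (hflow t ht),
    fun x v w => ⟨SpinorFlow.hasDerivAt_conformalMetric (r := fun s x => ‖ψ s x‖)
        (smooth_norm.hasDerivAt ht x).differentiableAt v w,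
      he.conformalVelocity_eq_frameTrace_mul smooth_norm norm_ne ht x v w⟩,
    fun φ hφ => he.hasDerivAt_dirac_conformal_const smooth_norm norm_ne hφ hU,
    fun A => he.hasDerivAt_measureReal_conformal smooth_norm norm_pos hU⟩
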